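/- For $\mathcal{R}\subseteq\Delta_n$ and $\mathcal{C}\subseteq\Delta_m$, where $\Delta_n=\{r\in\mathbb{R}^n: r_i\ge 0,\ \sum_i r_i=1\}$, and for $X\in\mathbb{R}^{n\times m}$, $u\in\mathbb{R}^n$, $v\in\mathbb{R}^m$, let $$\|X\|_{(\mathcal{R},\mathcal{C})}=\sup_{r\in\mathcal{R},\,c\in\mathcal{C}}\big\|\mathrm{diag}(r)^{1/2}\,X\,\mathrm{diag}(c)^{1/2}\big\|_{\mathrm{tr}},\qquad \|u\|_{\mathcal{R}}=\Big(\sup_{r\in\mathcal{R}}\sum_i r_iu_i^2\Big)^{1/2},\qquad \|v\|_{\mathcal{C}}=\Big(\sup_{c\in\mathcal{C}}\sum_j c_jv_j^2\Big)^{1/2},$$ where $\|\cdot\|_{\mathrm{tr}}$ is the trace norm (the sum of the singular values). Let $K_G$ be Grothendieck's constant, i.e. the smallest $K$ such that, for all $n,m,k$, all $Y\in\mathbb{R}^{n\times m}$ and all $U_1,\dots,U_n,V_1,\dots,V_m$ in the closed Euclidean unit ball of $\mathbb{R}^k$, $$\sum_{i,j}Y_{ij}\langle U_i,V_j\rangle\le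 K\cdot\sup\Big\{\sum_{i,j}Y_{ij}u_iv_j:\ |u_i|\le 1,\ |v_j|\le 1\Big\};$$ this smallest constant exists and satisfies $K_G\le 1.79$. **Theorem.** Let $\mathcal{R}\subseteq\Delta_n$ and $\mathcal{C}\subseteq\Delta_m$ be nonempty and convex. Then $$\mathrm{conv}\{uv^\top:\|u\|_{\mathcal{R}}=\|v\|_{\mathcal{C}}=1\}\subseteq\{X:\|X\|_{(\mathcal{R},\mathcal{C})}\le 1\}.$$ If moreover $\|\cdot\|_{(\mathcal{R},\mathcal{C})}$ is a norm, i.e. for every $i$ there is $r\in\mathcal{R}$ with $r_i>0$ and for every $j$ there is $c\in\mathcal{C}$ with $c_j>0$, then $$\{X:\|X\|_{(\mathcal{R},\mathcal{C})}\le 1\}\subseteq K_G\cdot\mathrm{conv}\{uv^\top:\|u\|_{\mathcal{R}}=\|v\|_{\mathcal{C}}=1\}.$$ Without this last assumption, the second inclusion still holds with $K_G$ replaced by any $K>K_G$. -/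

import Mathlib

open scoped Pointwise

noncomputable section

namespace LocalMaxNorm

/-- The trace norm of a real matrix: the sum of its singular values (with multiplicity). -/
def traceNorm {n m : ℕ} (X : Matrix (Fin n) (Fin m) ℝ) : ℝ :=
  ∑ j : Fin m, (Matrix.toEuclideanLin X).singularValues j

/-- The `(r, c)`-weighted trace norm `‖diag(r)^{1/2} X diag(c)^{1/2}‖_tr`. -/
def weightedTraceNorm {n m : ℕ} (r : Fin n → ℝ) (c : Fin m → ℝ)
    (X : Matrix (Fin n) (Fin m) ℝ) : ℝ :=
  traceNorm (Matrix.diagonal (fun i => √(r i)) * X * Matrix.diagonal (fun j => √(c j)))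

/-- The `(R, C)`-norm (local max norm): the supremum of the weighted trace norms over
`r ∈ R`, `c ∈ C`. -/
def rcNorm {n m : ℕ} (R : Set (Fin n → ℝ)) (C : Set (Fin m → ℝ))
    (X : Matrix (Fin n) (Fin m) ℝ) : ℝ :=
  sSup {t : ℝ | ∃ r ∈ R, ∃ c ∈ C, t = weightedTraceNorm r c X}

/-- The vector norm `‖u‖_R = √(sup_{r ∈ R} ∑ᵢ rᵢ uᵢ²)`. -/
def vecNorm {n : ℕ} (R : Set (Fin n → ℝ)) (u : Fin n → ℝ) : ℝ :=
  √(sSup {t : ℝ | ∃ r ∈ R, t = ∑ i, r i * u i ^ 2})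

/-- The convex hull of the rank-one matrices `u vᵀ` with `‖u‖_R = ‖v‖_C = 1`. -/
def rankOneHull {n m : ℕ} (R : Set (Fin n → ℝ)) (C : Set (Fin m → ℝ)) :
    Set (Matrix (Fin n) (Fin m) ℝ) :=
  convexHull ℝ {X | ∃ (u : Fin n → ℝ) (v : Fin m → ℝ),
    vecNorm R u = 1 ∧ vecNorm C v = 1 ∧ X = Matrix.vecMulVec u v}

/-- Every coordinate carries positive weight for some element of the set. For `R` and `C` together,
this is what makes the `(R, C)`-norm a norm and not only a seminorm. -/
def Nondegenerate {n : ℕ} (R : Set (Fin n → ℝ)) : Prop :=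
  ∀ i, ∃ r ∈ R, 0 < r i

/-- Grothendieck's inequality holds with constant `K`, for real matrices of all sizes and
unit-ball vectors in real Euclidean spaces of all finite dimensions. -/
def GrothendieckInequality (K : ℝ) : Prop :=
  ∀ (n m k : ℕ) (Y : Matrix (Fin n) (Fin m) ℝ)
    (U : Fin n → EuclideanSpace ℝ (Fin k)) (V : Fin m → EuclideanSpace ℝ (Fin k)),
    (∀ i, ‖U i‖ ≤ 1) → (∀ j, ‖V j‖ ≤ 1) →
    ∑ i, ∑ j, Y i j * inner ℝ (U i) (V j) ≤
      K * sSup {t : ℝ | ∃ (u : Fin n → ℝ) (v : Fin m → ℝ), (∀ i, |u i| ≤ 1) ∧ (∀ j, |v j| ≤ 1) ∧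
        t = ∑ i, ∑ j, Y i j * (u i * v j)}

/-- Grothendieck's (real) constant: the best constant in Grothendieck's inequality. -/
def grothendieckConstant : ℝ := sInf {K : ℝ | GrothendieckInequality K}

end LocalMaxNorm

end

/-! ### Gaussian signs and Sheppard's formula -/

namespace LocalMaxNorm

open MeasureTheory ProbabilityTheory

/-! Trace norm and operator norm are dual, so `rcNorm R C X ≤ 1` says that `∑ √(r i) X i j √(c j) W
i j ≤ 1` for all `r ∈ R`, `c ∈ C` and every contraction `W` (`rcNorm_le_one_iff`). For `X = u vᵀ`
this is the contraction bound at the vectors `√r u`, `√c v`, and the condition is convex in `X`: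
this is the first inclusion.

For the second, separate `K⁻¹ X` from the closed hull. The separating functional is a matrix `Y`
whose pairing with `u vᵀ` is at most 1 on the two unit balls, and `⟨X, Y⟩ ≤ K` is needed.
Grothendieck's inequality rescales to `∑ Y i j ⟨U i, V j⟩ ≤ K ‖(|U i|)‖_R ‖(|V j|)‖_C`. A second
separation, where convexity of `R` and `C` enters, turns this into one pair of weights in the
closures with `2 xᵀYy ≤ K (∑ r x² + ∑ c y²)` (`exists_weights`). Hence `Y = K diag(√r) W diag(√c)`
with `W` a contraction, and duality gives `⟨X, Y⟩ ≤ K`.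

This places `K⁻¹ X` in the closure of the hull. Under nondegeneracy the hull is compact; in general
0 is interior to it, so any larger constant absorbs the closure.

Grothendieck's inequality itself comes from Krivine's rounding: the signs of a Gaussian vector with
cross-correlations `sin (c ⟨U i, V j⟩)` have expected products `(2c/π) ⟨U i, V j⟩`, and such a
vector exists when `sinh c ≤ 1`. -/

lemma measurable_real_sign : Measurable Real.sign := by
  unfold Real.sign
  exact Measurable.ite measurableSet_Iio measurable_const
    (Measurable.ite measurableSet_Ioi measurable_const measurable_const)

lemma abs_real_sign_le_one (x : ℝ) : |Real.sign x| ≤ 1 := by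
  rcases Real.sign_apply_eq x with h | h | h <;> simp [h]

lemma real_sign_pos_mul {r : ℝ} (hr : 0 < r) (x : ℝ) : Real.sign (r * x) = Real.sign x := by
  rcases lt_trichotomy x 0 with h | h | h
  · rw [Real.sign_of_neg h, Real.sign_of_neg (mul_neg_of_pos_of_neg hr h)]
  · rw [h, mul_zero]
  · rw [Real.sign_of_pos h, Real.sign_of_pos (mul_pos hr h)]

lemma integral_real_sign {a b : ℝ} (ha : a ≤ 0) (hb : 0 ≤ b) :
    ∫ x in a..b, Real.sign x = a + b := by
  have hint : ∀ c d : ℝ, IntervalIntegrable Real.sign volume c d := fun c d =>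
    (intervalIntegrable_const (c := (1 : ℝ))).mono_fun'
      measurable_real_sign.aestronglyMeasurable
      (Filter.Eventually.of_forall fun x => by simpa using abs_real_sign_le_one x)
  rw [← intervalIntegral.integral_add_adjacent_intervals (hint a 0) (hint 0 b)]
  have h1 : ∫ x in a..0, Real.sign x = ∫ _x in a..0, (-1 : ℝ) := by
    rw [intervalIntegral.integral_of_le ha, intervalIntegral.integral_of_le ha,
      integral_Ioc_eq_integral_Ioo, integral_Ioc_eq_integral_Ioo]
    exact setIntegral_congr_fun measurableSet_Ioo fun x hx => Real.sign_of_neg hx.2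
  have h2 : ∫ x in 0..b, Real.sign x = ∫ _x in 0..b, (1 : ℝ) := by
    rw [intervalIntegral.integral_of_le hb, intervalIntegral.integral_of_le hb]
    exact setIntegral_congr_fun measurableSet_Ioc fun x hx => Real.sign_of_pos hx.1
  rw [h1, h2]
  simp

/-- Both factors flip under `φ ↦ φ + π`, so the integrand has period `π`. On `(-π/2, π/2)` the
cosine is positive and `|φ + α| < π`, so only `sign (φ + α)` remains, with integral `2α`. -/
lemma integral_sign_cos_mul_sign_sin_add {α : ℝ} (h1 : -(Real.pi / 2) ≤ α)
    (h2 : α ≤ Real.pi / 2) :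
    ∫ φ in Set.Ioo (-Real.pi) Real.pi, Real.sign (Real.cos φ) * Real.sign (Real.sin (φ + α)) =
      4 * α := by
  have hpi := Real.pi_pos
  set g : ℝ → ℝ := fun φ => Real.sign (Real.cos φ) * Real.sign (Real.sin (φ + α)) with hg
  have hgm : Measurable g :=
    (measurable_real_sign.comp Real.measurable_cos).mul
      (measurable_real_sign.comp (Real.measurable_sin.comp (measurable_id.add_const α)))
  have hint : ∀ c d : ℝ, IntervalIntegrable g volume c d := fun c d =>
    (intervalIntegrable_const (c := (1 : ℝ))).mono_fun' hgm.aestronglyMeasurable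
      (Filter.Eventually.of_forall fun x => by
        simp only [hg, norm_mul, Real.norm_eq_abs]
        exact mul_le_one₀ (abs_real_sign_le_one _) (abs_nonneg _) (abs_real_sign_le_one _))
  have hper : Function.Periodic g Real.pi := fun φ => by
    simp only [hg]
    rw [show φ + Real.pi + α = φ + α + Real.pi by ring, Real.cos_add_pi, Real.sin_add_pi,
      Real.sign_neg, Real.sign_neg, neg_mul_neg]
  have hhalf : ∫ φ in (-(Real.pi / 2))..(-(Real.pi / 2) + Real.pi), g φ = 2 * α := by
    have e1 : ∫ φ in (-(Real.pi / 2))..(-(Real.pi / 2) + Real.pi), g φ =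
        ∫ φ in (-(Real.pi / 2))..(-(Real.pi / 2) + Real.pi), Real.sign (φ + α) := by
      rw [intervalIntegral.integral_of_le (by linarith),
        intervalIntegral.integral_of_le (by linarith),
        integral_Ioc_eq_integral_Ioo, integral_Ioc_eq_integral_Ioo]
      refine setIntegral_congr_fun measurableSet_Ioo fun x hx => ?_
      have hx1 : -(Real.pi / 2) < x := hx.1
      have hx2 : x < Real.pi / 2 := by linarith [hx.2]
      simp only [hg]
      rw [Real.sign_of_pos (Real.cos_pos_of_mem_Ioo ⟨hx1, hx2⟩), one_mul]
      rcases lt_trichotomy (x + α) 0 with h | h | h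
      · rw [Real.sign_of_neg h,
          Real.sign_of_neg (Real.sin_neg_of_neg_of_neg_pi_lt h (by linarith))]
      · rw [h, Real.sin_zero]
      · rw [Real.sign_of_pos h, Real.sign_of_pos (Real.sin_pos_of_pos_of_lt_pi h (by linarith))]
    rw [e1, intervalIntegral.integral_comp_add_right (fun x => Real.sign x),
      integral_real_sign (by linarith) (by linarith)]
    ring
  rw [← integral_Ioc_eq_integral_Ioo, ← intervalIntegral.integral_of_le (by linarith),
    ← intervalIntegral.integral_add_adjacent_intervals (hint (-Real.pi) 0) (hint 0 Real.pi)]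
  have p1 := hper.intervalIntegral_add_eq (-Real.pi) (-(Real.pi / 2))
  have p2 := hper.intervalIntegral_add_eq 0 (-(Real.pi / 2))
  rw [neg_add_cancel] at p1
  rw [zero_add] at p2
  rw [p1, p2, hhalf]
  ring

lemma integral_mul_exp_neg_sq_div_two :
    ∫ r in Set.Ioi (0 : ℝ), r * Real.exp (-(r ^ 2) / 2) = 1 := by
  have h := integral_rpow_mul_exp_neg_mul_rpow (p := 2) (q := 1) (b := 1 / 2)
    (by norm_num) (by norm_num) (by norm_num)
  norm_num at h
  rw [← h]
  refine setIntegral_congr_fun measurableSet_Ioi fun r _ => ?_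
  ring_nf

/-- Sheppard's formula, for the pair `(x, x sin α + y cos α)` with `x`, `y` independent
standard Gaussians. -/
lemma integral_sign_mul_sign_gaussian_prod {α : ℝ} (h1 : -(Real.pi / 2) ≤ α)
    (h2 : α ≤ Real.pi / 2) :
    ∫ p : ℝ × ℝ, Real.sign p.1 * Real.sign (p.1 * Real.sin α + p.2 * Real.cos α)
      ∂((gaussianReal 0 1).prod (gaussianReal 0 1)) = 2 / Real.pi * α := by
  have hpi := Real.pi_pos
  rw [gaussianReal_of_var_ne_zero 0 one_ne_zero,
    prod_withDensity (measurable_gaussianPDF 0 1) (measurable_gaussianPDF 0 1),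
    integral_withDensity_eq_integral_toReal_smul
      (show Measurable fun z : ℝ × ℝ => gaussianPDF 0 1 z.1 * gaussianPDF 0 1 z.2 from
        ((measurable_gaussianPDF 0 1).comp measurable_fst).mul
        ((measurable_gaussianPDF 0 1).comp measurable_snd))
      (Filter.Eventually.of_forall fun p => ENNReal.mul_lt_top gaussianPDF_lt_top
        gaussianPDF_lt_top)]
  rw [← Measure.volume_eq_prod, ← integral_comp_polarCoord_symm, polarCoord_target]
  -- In polar coordinates the second argument is `r sin (φ + α)`; signs ignore `r`, so the integral
  -- splits into a radial and an angular factor.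
  have key : ∀ p ∈ Set.Ioi (0 : ℝ) ×ˢ Set.Ioo (-Real.pi) Real.pi,
      p.1 • ((gaussianPDF 0 1 (polarCoord.symm p).1 * gaussianPDF 0 1 (polarCoord.symm p).2).toReal •
        (Real.sign (polarCoord.symm p).1 * Real.sign ((polarCoord.symm p).1 * Real.sin α +
          (polarCoord.symm p).2 * Real.cos α))) =
      (p.1 * Real.exp (-(p.1 ^ 2) / 2)) *
        ((2 * Real.pi)⁻¹ * (Real.sign (Real.cos p.2) * Real.sign (Real.sin (p.2 + α)))) := by
    rintro ⟨r, φ⟩ ⟨hr, -⟩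
    have hr : 0 < r := hr
    simp only [polarCoord_symm_apply, smul_eq_mul, ENNReal.toReal_mul, toReal_gaussianPDF,
      gaussianPDFReal]
    have s1 : Real.sign (r * Real.cos φ) = Real.sign (Real.cos φ) := by
      exact real_sign_pos_mul hr _
    have s2 : Real.sign (r * Real.cos φ * Real.sin α + r * Real.sin φ * Real.cos α) =
        Real.sign (Real.sin (φ + α)) := by
      rw [Real.sin_add, show r * Real.cos φ * Real.sin α + r * Real.sin φ * Real.cos α =
        r * (Real.sin φ * Real.cos α + Real.cos φ * Real.sin α) by ring]
      exact real_sign_pos_mul hr _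
    rw [s1, s2]
    have s3 : Real.exp (-(r * Real.cos φ - 0) ^ 2 / (2 * ((1 : NNReal) : ℝ))) *
        Real.exp (-(r * Real.sin φ - 0) ^ 2 / (2 * ((1 : NNReal) : ℝ))) =
        Real.exp (-(r ^ 2) / 2) := by
      rw [← Real.exp_add]
      congr 1
      have := Real.sin_sq_add_cos_sq φ
      simp only [NNReal.coe_one]
      linear_combination (-(r ^ 2) / 2) * this
    have s4 : (√(2 * Real.pi * ((1 : NNReal) : ℝ)))⁻¹ * (√(2 * Real.pi * ((1 : NNReal) : ℝ)))⁻¹ =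
        (2 * Real.pi)⁻¹ := by
      rw [← mul_inv, Real.mul_self_sqrt (by positivity), NNReal.coe_one, mul_one]
    linear_combination (r * Real.sign (Real.cos φ) * Real.sign (Real.sin (φ + α))) *
      ((√(2 * Real.pi * ((1 : NNReal) : ℝ)))⁻¹ * (√(2 * Real.pi * ((1 : NNReal) : ℝ)))⁻¹ * s3 +
        Real.exp (-(r ^ 2) / 2) * s4)
  rw [setIntegral_congr_fun (measurableSet_Ioi.prod measurableSet_Ioo) key,
    Measure.volume_eq_prod,
    setIntegral_prod_mul (fun r : ℝ => r * Real.exp (-(r ^ 2) / 2)) (fun φ : ℝ =>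
      (2 * Real.pi)⁻¹ * (Real.sign (Real.cos φ) * Real.sign (Real.sin (φ + α)))),
    integral_mul_exp_neg_sq_div_two, integral_const_mul,
    integral_sign_cos_mul_sign_sin_add h1 h2]
  field_simp
  ring

/-- Both characteristic functions are `exp (-(s² + 2st sin α + t²)/2)`, by `sin² + cos² = 1`. -/
lemma map_pair_multivariateGaussian {ι : Type*} [Fintype ι] [DecidableEq ι] {S : Matrix ι ι ℝ}
    (hS : S.PosSemidef) {a b : ι} (ha : S a a = 1) (hb : S b b = 1) {α : ℝ}
    (hα : S a b = Real.sin α) :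
    (multivariateGaussian 0 S).map (fun x => ((x a, x b) : ℝ × ℝ)) =
      ((gaussianReal 0 1).prod (gaussianReal 0 1)).map
        (fun p => (p.1, p.1 * Real.sin α + p.2 * Real.cos α)) := by
  let F : EuclideanSpace ℝ ι →L[ℝ] ℝ × ℝ :=
    (EuclideanSpace.proj a).prod (EuclideanSpace.proj b)
  let G : ℝ × ℝ →L[ℝ] ℝ × ℝ :=
    (ContinuousLinearMap.fst ℝ ℝ ℝ).prod (Real.sin α • ContinuousLinearMap.fst ℝ ℝ ℝ +
      Real.cos α • ContinuousLinearMap.snd ℝ ℝ ℝ)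
  have hF : (fun x : EuclideanSpace ℝ ι => ((x a, x b) : ℝ × ℝ)) = F := by
    ext x <;> simp [F]
  have hG : (fun p : ℝ × ℝ => (p.1, p.1 * Real.sin α + p.2 * Real.cos α)) = G := by
    ext p <;> simp [G, mul_comm]
  rw [hF, hG]
  have : IsProbabilityMeasure ((multivariateGaussian 0 S).map F) :=
    Measure.isProbabilityMeasure_map (by fun_prop)
  have : IsProbabilityMeasure (((gaussianReal 0 1).prod (gaussianReal 0 1)).map G) :=
    Measure.isProbabilityMeasure_map (by fun_prop)
  refine Measure.ext_of_charFunDual (funext fun L => ?_)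
  rw [charFunDual_map, charFunDual_map, charFunDual_prod]
  set s : ℝ := L (1, 0)
  set t : ℝ := L (0, 1)
  have hL : ∀ x y : ℝ, L (x, y) = s * x + t * y := fun x y => by
    have : ((x, y) : ℝ × ℝ) = x • (1, 0) + y • (0, 1) := by simp
    rw [this, map_add, map_smul, map_smul, smul_eq_mul, smul_eq_mul]
    ring
  have hreal : ∀ (M : StrongDual ℝ ℝ), charFunDual (gaussianReal 0 1) M =
      Complex.exp (-((M 1 : ℝ) : ℂ) ^ 2 / 2) := fun M => by
    have := charFun_gaussianReal (μ := 0) (v := 1) (M 1)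
    rw [charFun_apply_real] at this
    rw [charFunDual_apply]
    have h2 : ∀ x : ℝ, M x = M 1 * x := fun x => by
      conv_lhs => rw [← mul_one x, ← smul_eq_mul, map_smul, smul_eq_mul, mul_comm]
    rw [show (fun x : ℝ => Complex.exp ((M x : ℝ) * Complex.I)) =
      fun x : ℝ => Complex.exp ((M 1 : ℝ) * (x : ℂ) * Complex.I) from
        funext fun x => by rw [h2 x, Complex.ofReal_mul], this]
    congr 1
    simp
    ring
  rw [hreal, hreal]
  have hleft : charFunDual (multivariateGaussian 0 S) (L.comp F) =
      charFun (multivariateGaussian 0 S)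
        (EuclideanSpace.single a s + EuclideanSpace.single b t) := by
    rw [charFunDual_apply, charFun_apply]
    congr 1
    ext x
    congr 2
    have : L (F x) = s * x a + t * x b := by rw [← hL]; simp [F]
    simp [this, inner_add_right, EuclideanSpace.inner_single_right]
  rw [hleft, charFun_multivariateGaussian hS, ← Complex.exp_add]
  have hba : S b a = S a b := by simpa using hS.isHermitian.apply a b
  have hq : ((EuclideanSpace.single a s + EuclideanSpace.single b t : EuclideanSpace ℝ ι) : ι → ℝ)
      ⬝ᵥ S.mulVec ((EuclideanSpace.single a s + EuclideanSpace.single b t : EuclideanSpace ℝ ι)) =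
      s ^ 2 + 2 * s * t * Real.sin α + t ^ 2 := by
    simp [Matrix.mulVec_add, ha, hb, hba, hα]
    ring
  have c1 : (L.comp G).comp (ContinuousLinearMap.inl ℝ ℝ ℝ) 1 = s + t * Real.sin α := by
    simp [G, hL]
  have c2 : (L.comp G).comp (ContinuousLinearMap.inr ℝ ℝ ℝ) 1 = t * Real.cos α := by
    simp [G, hL]
  rw [hq, c1, c2]
  congr 1
  simp only [inner_zero_right, Complex.ofReal_zero, zero_mul, zero_sub]
  norm_cast
  rw [← sub_eq_zero]
  have := Real.sin_sq_add_cos_sq α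
  linear_combination (t ^ 2 / 2) * this

/-- Sheppard's formula: `E[sgn X_a sgn X_b] = (2 / π) arcsin S_{ab}` for a centred Gaussian
vector `X` with covariance `S`, if `X_a` and `X_b` have unit variance. -/
lemma integral_sign_mul_sign_multivariateGaussian {ι : Type*} [Fintype ι] [DecidableEq ι]
    {S : Matrix ι ι ℝ} (hS : S.PosSemidef) {a b : ι} (ha : S a a = 1) (hb : S b b = 1) {α : ℝ}
    (hα : S a b = Real.sin α) (h1 : -(Real.pi / 2) ≤ α) (h2 : α ≤ Real.pi / 2) :
    ∫ x, Real.sign (x a) * Real.sign (x b) ∂(multivariateGaussian 0 S) = 2 / Real.pi * α := by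
  have hm : Measurable fun p : ℝ × ℝ => Real.sign p.1 * Real.sign p.2 :=
    (measurable_real_sign.comp measurable_fst).mul (measurable_real_sign.comp measurable_snd)
  have e1 := integral_map (μ := multivariateGaussian 0 S) (φ := fun x => ((x a, x b) : ℝ × ℝ))
    (by fun_prop) hm.aestronglyMeasurable
  have e2 := integral_map (μ := (gaussianReal 0 1).prod (gaussianReal 0 1))
    (φ := fun p : ℝ × ℝ => (p.1, p.1 * Real.sin α + p.2 * Real.cos α))
    (by fun_prop) hm.aestronglyMeasurable
  rw [map_pair_multivariateGaussian hS ha hb hα] at e1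
  rw [← integral_sign_mul_sign_gaussian_prod h1 h2, ← e2, e1]

/-! ### Krivine's covariance and Grothendieck's inequality -/

lemma posSemidef_iff_sum {ι : Type*} [Fintype ι] {M : Matrix ι ι ℝ}
    (hM : ∀ a b, M a b = M b a) :
    M.PosSemidef ↔ ∀ x : ι → ℝ, 0 ≤ ∑ a, ∑ b, x a * M a b * x b := by
  have hH : M.IsHermitian := Matrix.IsHermitian.ext fun a b => by simp [hM a b]
  have e : ∀ x : ι → ℝ, star x ⬝ᵥ M.mulVec x = ∑ a, ∑ b, x a * M a b * x b := fun x => by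
    simp [dotProduct, Matrix.mulVec, Finset.mul_sum, mul_assoc]
  rw [Matrix.posSemidef_iff_dotProduct_mulVec]
  simp only [e]
  exact and_iff_right hH

lemma posSemidef_hadamard_pow {ι : Type*} [Fintype ι] {G : Matrix ι ι ℝ} (hG : G.PosSemidef)
    (k : ℕ) : (Matrix.of fun a b => G a b ^ (k + 1)).PosSemidef := by
  induction k with
  | zero => convert hG using 1; ext a b; simp
  | succ k ih => exact ih.hadamard hG

/-- Krivine's construction of a Gaussian covariance. -/
lemma exists_posSemidef_sin {ι : Type*} [Fintype ι] [DecidableEq ι] {G : Matrix ι ι ℝ}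
    (hG : G.PosSemidef) (hdiag : ∀ a, G a a ≤ 1) {e : ι → ℝ} (he : ∀ a, e a = 1 ∨ e a = -1)
    {c : ℝ} (hc0 : 0 ≤ c) (hc : Real.sinh c ≤ 1) :
    ∃ S : Matrix ι ι ℝ, S.PosSemidef ∧ (∀ a, S a a = 1) ∧
      ∀ a b, e a = 1 → e b = -1 → S a b = Real.sin (c * G a b) := by
  have hGs : ∀ a b, G a b = G b a := fun a b => by simpa using hG.isHermitian.apply b a
  -- The `sin` series is the `sinh` series with signs `(-1)^l`, which equal `e a ^ l * e b ^ l`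
  -- across the two classes. So `N` is a nonnegative combination of odd Hadamard powers of `G`,
  -- conjugated by `diag(e)^l`.
  set N : Matrix ι ι ℝ := Matrix.of fun a b =>
    if e a = e b then Real.sinh (c * G a b) else Real.sin (c * G a b) with hN
  have hNs : ∀ a b, N a b = N b a := fun a b => by
    simp only [hN, Matrix.of_apply, hGs a b, eq_comm]
  have hsum : ∀ a b, HasSum (fun l : ℕ => c ^ (2 * l + 1) / (2 * l + 1).factorial *
      (e a ^ l * G a b ^ (2 * l + 1) * e b ^ l)) (N a b) := fun a b => by
    simp only [hN, Matrix.of_apply]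
    split_ifs with h
    · convert Real.hasSum_sinh (c * G a b) using 2 with l
      have : e a ^ l * e b ^ l = 1 := by
        rw [← h, ← mul_pow]
        rcases he a with h | h <;> simp [h]
      rw [mul_pow]
      linear_combination (c ^ (2 * l + 1) / (2 * l + 1).factorial * G a b ^ (2 * l + 1)) * this
    · convert Real.hasSum_sin (c * G a b) using 2 with l
      have : e a ^ l * e b ^ l = (-1) ^ l := by
        rw [← mul_pow]
        rcases he a with h1 | h1 <;> rcases he b with h2 | h2 <;> simp_all
      rw [mul_pow]
      linear_combination (c ^ (2 * l + 1) / (2 * l + 1).factorial * G a b ^ (2 * l + 1)) * this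
  have hNpsd : N.PosSemidef := by
    rw [posSemidef_iff_sum hNs]
    intro x
    have hx : HasSum (fun l : ℕ => ∑ a, ∑ b, x a * (c ^ (2 * l + 1) / (2 * l + 1).factorial *
      (e a ^ l * G a b ^ (2 * l + 1) * e b ^ l)) * x b) (∑ a, ∑ b, x a * N a b * x b) :=
      hasSum_sum fun a _ => hasSum_sum fun b _ => ((hsum a b).mul_left (x a)).mul_right (x b)
    refine hx.nonneg fun l => ?_
    have hp := (posSemidef_iff_sum (fun a b => by simp [hGs a b])).1
      (posSemidef_hadamard_pow hG (2 * l)) fun a => x a * e a ^ l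
    have : ∑ a, ∑ b, x a * (c ^ (2 * l + 1) / (2 * l + 1).factorial *
        (e a ^ l * G a b ^ (2 * l + 1) * e b ^ l)) * x b =
        c ^ (2 * l + 1) / (2 * l + 1).factorial * ∑ a, ∑ b, x a * e a ^ l *
          Matrix.of (fun a b => G a b ^ (2 * l + 1)) a b * (x b * e b ^ l) := by
      simp only [Finset.mul_sum, Matrix.of_apply]
      refine Finset.sum_congr rfl fun a _ => Finset.sum_congr rfl fun b _ => ?_
      ring
    rw [this]
    exact mul_nonneg (by positivity) hp
  -- Since `N a a = sinh (c * G a a) ≤ 1`, the diagonal can be raised to 1 without touching the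
  -- cross entries.
  refine ⟨N + Matrix.diagonal fun a => 1 - N a a, hNpsd.add (Matrix.PosSemidef.diagonal ?_),
    fun a => by simp, fun a b ha hb => ?_⟩
  · intro a
    have : N a a = Real.sinh (c * G a a) := by simp [hN]
    have h2 : Real.sinh (c * G a a) ≤ Real.sinh c :=
      Real.sinh_le_sinh.2 (mul_le_of_le_one_right hc0 (hdiag a))
    simp only [Pi.zero_apply]
    linarith
  · have hab : a ≠ b := by
      rintro rfl
      rw [ha] at hb
      norm_num at hb
    have : ¬ e a = e b := by rw [ha, hb]; norm_num
    simp [hN, this, Matrix.diagonal_apply_ne _ hab]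

/-- `22 / 25` is just below `arsinh 1 ≈ 0.8814`, yet large enough for `π / (2 * 22/25) < 1.79`. -/
lemma sinh_le_one : Real.sinh (22 / 25) ≤ 1 := by
  have h1 : Real.exp (22 / 25) ≤ 2.4111 := by
    refine (Real.exp_bound' (by norm_num) (by norm_num) (n := 8) (by norm_num)).trans ?_
    norm_num [Finset.sum_range_succ, Nat.factorial]
  have h2 : (0.4147 : ℝ) ≤ Real.exp (-(22 / 25)) := by
    rw [Real.exp_neg, le_inv_comm₀ (by norm_num) (Real.exp_pos _)]
    exact h1.trans (by norm_num)
  rw [Real.sinh_eq]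
  linarith

lemma bddAbove_bilin {n m : ℕ} (Y : Matrix (Fin n) (Fin m) ℝ) :
    BddAbove {t : ℝ | ∃ (u : Fin n → ℝ) (v : Fin m → ℝ), (∀ i, |u i| ≤ 1) ∧ (∀ j, |v j| ≤ 1) ∧
        t = ∑ i, ∑ j, Y i j * (u i * v j)} := by
  refine ⟨∑ i, ∑ j, |Y i j|, ?_⟩
  rintro t ⟨u, v, hu, hv, rfl⟩
  refine Finset.sum_le_sum fun i _ => Finset.sum_le_sum fun j _ => (le_abs_self _).trans ?_
  rw [abs_mul, abs_mul]
  exact mul_le_of_le_one_right (abs_nonneg _) (mul_le_one₀ (hu i) (abs_nonneg _) (hv j))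

lemma bilin_sSup_nonneg {n m : ℕ} (Y : Matrix (Fin n) (Fin m) ℝ) :
    0 ≤ sSup {t : ℝ | ∃ (u : Fin n → ℝ) (v : Fin m → ℝ), (∀ i, |u i| ≤ 1) ∧ (∀ j, |v j| ≤ 1) ∧
        t = ∑ i, ∑ j, Y i j * (u i * v j)} :=
  le_csSup (bddAbove_bilin Y) ⟨0, 0, by simp, by simp, by simp⟩

/-- Grothendieck's inequality, by Krivine's argument with `22 / 25` in place of `arsinh 1`. -/
theorem grothendieckInequality_of_krivine : GrothendieckInequality 1.79 := by
  intro n m k Y U V hU hV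
  set s := sSup {t : ℝ | ∃ (u : Fin n → ℝ) (v : Fin m → ℝ), (∀ i, |u i| ≤ 1) ∧ (∀ j, |v j| ≤ 1) ∧
        t = ∑ i, ∑ j, Y i j * (u i * v j)} with hs
  have hpi := Real.pi_pos
  obtain ⟨S, hS, hS1, hSsin⟩ := exists_posSemidef_sin
    (Matrix.posSemidef_gram ℝ (Sum.elim U V))
    (fun a => by
      rw [Matrix.gram_apply, real_inner_self_eq_norm_sq]
      rcases a with i | j
      · simpa using pow_le_one₀ (n := 2) (norm_nonneg _) (hU i)
      · simpa using pow_le_one₀ (n := 2) (norm_nonneg _) (hV j))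
    (e := Sum.elim (fun _ => 1) (fun _ => -1)) (by rintro (i | j) <;> simp)
    (c := 22 / 25) (by norm_num) sinh_le_one
  have hint : ∀ a b, Integrable (fun x : EuclideanSpace ℝ (Fin n ⊕ Fin m) =>
      Real.sign (x a) * Real.sign (x b)) (multivariateGaussian 0 S) := fun a b =>
    Integrable.of_bound
      (((measurable_real_sign.comp (by fun_prop : Measurable
          fun x : EuclideanSpace ℝ (Fin n ⊕ Fin m) => x a)).mul
        (measurable_real_sign.comp (by fun_prop : Measurable
          fun x : EuclideanSpace ℝ (Fin n ⊕ Fin m) => x b))).aestronglyMeasurable) 1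
      (Filter.Eventually.of_forall fun x => by
        rw [norm_mul]
        exact mul_le_one₀ (abs_real_sign_le_one _) (abs_nonneg _) (abs_real_sign_le_one _))
  have hval : ∀ i j, ∫ x, Real.sign (x (Sum.inl i)) * Real.sign (x (Sum.inr j))
      ∂(multivariateGaussian 0 S) = 2 / Real.pi * (22 / 25 * inner ℝ (U i) (V j)) := fun i j => by
    have hle : |inner ℝ (U i) (V j)| ≤ 1 := (abs_real_inner_le_norm _ _).trans
      (mul_le_one₀ (hU i) (norm_nonneg _) (hV j))
    have h3 := Real.pi_gt_three
    rw [abs_le] at hle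
    refine integral_sign_mul_sign_multivariateGaussian hS (hS1 _) (hS1 _) ?_ (by linarith)
      (by linarith)
    rw [hSsin _ _ rfl rfl, Matrix.gram_apply, Sum.elim_inl, Sum.elim_inr]
  have hintY : ∀ i j, Integrable (fun x : EuclideanSpace ℝ (Fin n ⊕ Fin m) =>
      Y i j * (Real.sign (x (Sum.inl i)) * Real.sign (x (Sum.inr j))))
      (multivariateGaussian 0 S) := fun i j => (hint _ _).const_mul _
  have hmean : ∫ x, ∑ i, ∑ j, Y i j * (Real.sign (x (Sum.inl i)) * Real.sign (x (Sum.inr j)))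
      ∂(multivariateGaussian 0 S) ≤ s := by
    have : ∫ _x, s ∂(multivariateGaussian 0 S) = s := by simp
    rw [← this]
    refine integral_mono (integrable_finsetSum _ fun i _ => integrable_finsetSum _ fun j _ =>
      hintY i j) (integrable_const _) fun x => ?_
    exact le_csSup (bddAbove_bilin Y) ⟨fun i => Real.sign (x (Sum.inl i)),
      fun j => Real.sign (x (Sum.inr j)), fun _ => abs_real_sign_le_one _,
      fun _ => abs_real_sign_le_one _, rfl⟩
  rw [integral_finsetSum _ fun i _ => integrable_finsetSum _ fun j _ => hintY i j] at hmean
  simp_rw [fun i => integral_finsetSum Finset.univ fun j _ => hintY i j, integral_const_mul,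
    hval] at hmean
  have hs0 : 0 ≤ s := bilin_sSup_nonneg Y
  have e : ∑ i, ∑ j, Y i j * (2 / Real.pi * (22 / 25 * inner ℝ (U i) (V j))) =
      (44 / 25) / Real.pi * ∑ i, ∑ j, Y i j * inner ℝ (U i) (V j) := by
    simp only [Finset.mul_sum]
    refine Finset.sum_congr rfl fun i _ => Finset.sum_congr rfl fun j _ => ?_
    ring
  rw [e, div_mul_eq_mul_div, div_le_iff₀ hpi] at hmean
  have hpi2 := Real.pi_lt_d4
  have : s * Real.pi ≤ s * 3.1416 := mul_le_mul_of_nonneg_left hpi2.le hs0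
  norm_num at this ⊢
  linarith

lemma GrothendieckInequality.one_le {K : ℝ} (hK : GrothendieckInequality K) : 1 ≤ K := by
  have h := hK 1 1 1 (fun _ _ => 1) (fun _ => EuclideanSpace.single 0 1)
    (fun _ => EuclideanSpace.single 0 1) (by simp) (by simp)
  have hs : sSup {t : ℝ | ∃ (u : Fin 1 → ℝ) (v : Fin 1 → ℝ), (∀ i, |u i| ≤ 1) ∧
      (∀ j, |v j| ≤ 1) ∧ t = ∑ i, ∑ j, (1 : ℝ) * (u i * v j)} = 1 := by
    refine IsGreatest.csSup_eq ⟨⟨1, 1, by simp, by simp, by simp⟩, ?_⟩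
    rintro t ⟨u, v, hu, hv, rfl⟩
    simp only [Finset.univ_unique, Finset.sum_singleton, one_mul]
    refine (le_abs_self _).trans ?_
    rw [abs_mul]
    exact mul_le_one₀ (hu _) (abs_nonneg _) (hv _)
  rw [hs] at h
  simpa using h

/-- Each instance of the inequality is a closed condition on `K`, so the infimum is attained. -/
lemma isLeast_grothendieckConstant :
    IsLeast {K : ℝ | GrothendieckInequality K} grothendieckConstant := by
  have hbdd : BddBelow {K : ℝ | GrothendieckInequality K} := ⟨1, fun K hK => hK.one_le⟩
  refine ⟨fun n m k Y U V hU hV => ?_, fun K hK => csInf_le hbdd hK⟩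
  refine le_of_forall_pos_le_add fun ε hε => ?_
  have hs0 := bilin_sSup_nonneg Y
  set s := sSup {t : ℝ | ∃ (u : Fin n → ℝ) (v : Fin m → ℝ), (∀ i, |u i| ≤ 1) ∧ (∀ j, |v j| ≤ 1) ∧
        t = ∑ i, ∑ j, Y i j * (u i * v j)} with hs
  -- The denominator `s + 1` allows for `s = 0`.
  obtain ⟨K, hK, hlt⟩ := exists_lt_of_csInf_lt ⟨_, grothendieckInequality_of_krivine⟩
    (lt_add_of_pos_right grothendieckConstant (show 0 < ε / (s + 1) by positivity))
  refine (hK n m k Y U V hU hV).trans ?_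
  rw [← hs]
  have h1 : K * s ≤ (grothendieckConstant + ε / (s + 1)) * s :=
    mul_le_mul_of_nonneg_right hlt.le hs0
  have h2 : ε / (s + 1) * s ≤ ε := by
    rw [div_mul_eq_mul_div, div_le_iff₀ (by positivity)]
    nlinarith
  linarith

end LocalMaxNorm

/-! ### Duality of trace norm and operator norm -/

namespace LocalMaxNorm

/-- The operator norm of `W` is at most `κ`, expressed through the bilinear form of `W`. -/
def BilinBound {n m : ℕ} (W : Matrix (Fin n) (Fin m) ℝ) (κ : ℝ) : Prop :=
  ∀ (x : Fin n → ℝ) (y : Fin m → ℝ),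
    2 * ∑ i, ∑ j, x i * W i j * y j ≤ κ * (∑ i, x i ^ 2 + ∑ j, y j ^ 2)

section Duality

variable {n m : ℕ}

lemma inner_toEuclideanLin (W : Matrix (Fin n) (Fin m) ℝ) (x : EuclideanSpace ℝ (Fin n))
    (y : EuclideanSpace ℝ (Fin m)) :
    inner ℝ x (Matrix.toEuclideanLin W y) = ∑ i, ∑ j, x i * W i j * y j := by
  rw [PiLp.inner_apply]
  refine Finset.sum_congr rfl fun i _ => ?_
  simp only [Matrix.toLpLin_apply, Matrix.mulVec, dotProduct, RCLike.inner_apply, conj_trivial,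
    Finset.sum_mul]
  exact Finset.sum_congr rfl fun j _ => by ring

lemma BilinBound.inner_le {W : Matrix (Fin n) (Fin m) ℝ} {κ : ℝ} (hW : BilinBound W κ)
    (x : EuclideanSpace ℝ (Fin n)) (y : EuclideanSpace ℝ (Fin m)) :
    2 * inner ℝ x (Matrix.toEuclideanLin W y) ≤ κ * (‖x‖ ^ 2 + ‖y‖ ^ 2) := by
  rw [inner_toEuclideanLin, EuclideanSpace.real_norm_sq_eq, EuclideanSpace.real_norm_sq_eq]
  exact hW x y

lemma bilinBound_of_norm_le {W : Matrix (Fin n) (Fin m) ℝ}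
    (hW : ∀ y, ‖Matrix.toEuclideanLin W y‖ ≤ ‖y‖) : BilinBound W 1 := by
  intro x y
  have h := inner_toEuclideanLin W (WithLp.toLp 2 x) (WithLp.toLp 2 y)
  have h1 := EuclideanSpace.real_norm_sq_eq (WithLp.toLp 2 x)
  have h2 := EuclideanSpace.real_norm_sq_eq (WithLp.toLp 2 y)
  simp only at h h1 h2
  rw [← h, ← h1, ← h2]
  have h3 := real_inner_le_norm (WithLp.toLp 2 x)
    (Matrix.toEuclideanLin W (WithLp.toLp 2 y))
  nlinarith [hW (WithLp.toLp 2 y), norm_nonneg (WithLp.toLp 2 x), norm_nonneg (WithLp.toLp 2 y),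
    sq_nonneg (‖WithLp.toLp 2 x‖ - ‖WithLp.toLp 2 y‖)]

/-- Both sides are the trace of `AᵀW`, which any orthonormal basis computes. -/
lemma sum_inner_orthonormalBasis (A W : Matrix (Fin n) (Fin m) ℝ)
    (e : OrthonormalBasis (Fin m) ℝ (EuclideanSpace ℝ (Fin m))) :
    ∑ k, inner ℝ (Matrix.toEuclideanLin A (e k)) (Matrix.toEuclideanLin W (e k)) =
      ∑ i, ∑ j, A i j * W i j := by
  have h : ∀ b : OrthonormalBasis (Fin m) ℝ (EuclideanSpace ℝ (Fin m)),
      ∑ k, inner ℝ (Matrix.toEuclideanLin A (b k)) (Matrix.toEuclideanLin W (b k)) =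
      LinearMap.trace ℝ _ ((Matrix.toEuclideanLin A).adjoint ∘ₗ Matrix.toEuclideanLin W) :=
    fun b => by
      rw [LinearMap.trace_eq_sum_inner _ b]
      simp [LinearMap.adjoint_inner_right]
  rw [h e, ← h (EuclideanSpace.basisFun (Fin m) ℝ), Finset.sum_comm]
  refine Finset.sum_congr rfl fun j _ => ?_
  rw [PiLp.inner_apply]
  refine Finset.sum_congr rfl fun i _ => ?_
  simp [Matrix.toLpLin_apply, mul_comm]

/-- An orthonormal basis of right singular vectors. -/
lemma exists_orthonormalBasis_singularValues (A : Matrix (Fin n) (Fin m) ℝ) :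
    ∃ e : OrthonormalBasis (Fin m) ℝ (EuclideanSpace ℝ (Fin m)), ∀ k l,
      inner ℝ (Matrix.toEuclideanLin A (e k)) (Matrix.toEuclideanLin A (e l)) =
        if k = l then (Matrix.toEuclideanLin A).singularValues k ^ 2 else 0 := by
  set T := Matrix.toEuclideanLin A
  have hn : Module.finrank ℝ (EuclideanSpace ℝ (Fin m)) = m := by simp
  refine ⟨T.isSymmetric_adjoint_comp_self.eigenvectorBasis hn, fun k l => ?_⟩
  rw [T.sq_singularValues_fin hn, ← LinearMap.adjoint_inner_left]
  have := T.isSymmetric_adjoint_comp_self.apply_eigenvectorBasis hn k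
  rw [LinearMap.comp_apply] at this
  rw [this, inner_smul_left, OrthonormalBasis.inner_eq_ite]
  split_ifs <;> simp

/-- In a basis of right singular vectors the `k`-th term is at most `κ σ_k`: test `W` on the unit
vectors `A e_k / σ_k` and `e_k`. -/
lemma BilinBound.sum_mul_le {A W : Matrix (Fin n) (Fin m) ℝ} {κ : ℝ}
    (hW : BilinBound W κ) : ∑ i, ∑ j, A i j * W i j ≤ κ * traceNorm A := by
  obtain ⟨e, he⟩ := exists_orthonormalBasis_singularValues A
  rw [← sum_inner_orthonormalBasis A W e, traceNorm, Finset.mul_sum]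
  refine Finset.sum_le_sum fun k _ => ?_
  set σ := (Matrix.toEuclideanLin A).singularValues k with hσ
  have hnorm : ‖Matrix.toEuclideanLin A (e k)‖ ^ 2 = σ ^ 2 := by
    rw [← real_inner_self_eq_norm_sq, he, if_pos rfl]
  have hσ0 : 0 ≤ σ := LinearMap.singularValues_nonneg _ k
  clear_value σ
  rcases hσ0.eq_or_lt with h0 | h0
  · have : Matrix.toEuclideanLin A (e k) = 0 := by
      rw [← h0] at hnorm
      simpa using hnorm
    rw [this, inner_zero_left, ← h0, mul_zero]
  · have h := hW.inner_le (σ⁻¹ • Matrix.toEuclideanLin A (e k)) (e k)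
    rw [norm_smul, mul_pow, hnorm, e.norm_eq_one, real_inner_smul_left, norm_inv,
      Real.norm_of_nonneg h0.le, ← mul_pow, inv_mul_cancel₀ h0.ne'] at h
    have h2 : σ⁻¹ * inner ℝ (Matrix.toEuclideanLin A (e k)) (Matrix.toEuclideanLin W (e k)) ≤ κ := by
      linarith
    rwa [inv_mul_le_iff₀ h0, mul_comm] at h2

/-- The extremal `W` is the partial isometry of the polar decomposition, `e_k ↦ A e_k / σ_k`; the
convention `0⁻¹ = 0` kills the kernel of `A`. -/
lemma exists_bilinBound_eq_traceNorm (A : Matrix (Fin n) (Fin m) ℝ) :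
    ∃ W : Matrix (Fin n) (Fin m) ℝ, BilinBound W 1 ∧ ∑ i, ∑ j, A i j * W i j = traceNorm A := by
  obtain ⟨e, he⟩ := exists_orthonormalBasis_singularValues A
  set σ : Fin m → ℝ := fun k => (Matrix.toEuclideanLin A).singularValues k with hσ
  let L : EuclideanSpace ℝ (Fin m) →ₗ[ℝ] EuclideanSpace ℝ (Fin n) :=
    e.toBasis.constr ℝ fun k => (σ k)⁻¹ • Matrix.toEuclideanLin A (e k)
  have hLe : ∀ k, L (e k) = (σ k)⁻¹ • Matrix.toEuclideanLin A (e k) := fun k => by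
    rw [← e.coe_toBasis]
    exact e.toBasis.constr_basis ℝ _ k
  have hL : ∀ y, L y = ∑ k, inner ℝ (e k) y • L (e k) := fun y => by
    conv_lhs => rw [← e.sum_repr' y]
    simp
  refine ⟨Matrix.toEuclideanLin.symm L, bilinBound_of_norm_le fun y => ?_, ?_⟩
  · rw [LinearEquiv.apply_symm_apply]
    refine le_of_sq_le_sq ?_ (norm_nonneg _)
    rw [← e.sum_sq_inner_right y, ← real_inner_self_eq_norm_sq, hL y, sum_inner]
    refine Finset.sum_le_sum fun k _ => ?_
    rw [inner_sum, Finset.sum_eq_single k]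
    · rw [hLe, inner_smul_left, inner_smul_left, inner_smul_right, inner_smul_right, he,
        if_pos rfl]
      have h1 : ((σ k)⁻¹ * σ k) ^ 2 ≤ 1 := by
        by_cases h : σ k = 0
        · simp [h]
        · simp [inv_mul_cancel₀ h]
      simp only [conj_trivial]
      calc _ = inner ℝ (e k) y ^ 2 * ((σ k)⁻¹ * σ k) ^ 2 := by ring
        _ ≤ _ := mul_le_of_le_one_right (sq_nonneg _) h1
    · intro l _ hl
      rw [hLe, hLe, inner_smul_left, inner_smul_left, inner_smul_right, inner_smul_right, he,
        if_neg hl.symm]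
      simp
    · simp
  · rw [← sum_inner_orthonormalBasis _ _ e, LinearEquiv.apply_symm_apply, traceNorm]
    refine Finset.sum_congr rfl fun k _ => ?_
    rw [hLe, inner_smul_right, he, if_pos rfl]
    change (σ k)⁻¹ * σ k ^ 2 = σ k
    by_cases h : σ k = 0
    · simp [h]
    · field_simp

lemma weightedTraceNorm_le_iff {r : Fin n → ℝ} {c : Fin m → ℝ} {X : Matrix (Fin n) (Fin m) ℝ}
    {t : ℝ} : weightedTraceNorm r c X ≤ t ↔
      ∀ W, BilinBound W 1 → ∑ i, ∑ j, √(r i) * X i j * √(c j) * W i j ≤ t := by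
  have e : ∀ i j, (Matrix.diagonal (fun i => √(r i)) * X *
      Matrix.diagonal (fun j => √(c j))) i j = √(r i) * X i j * √(c j) := fun i j => by
    simp
  constructor
  · intro h W hW
    have := hW.sum_mul_le (A := Matrix.diagonal (fun i => √(r i)) * X *
      Matrix.diagonal (fun j => √(c j)))
    simp_rw [e, one_mul] at this
    exact this.trans h
  · intro h
    obtain ⟨W, hW, hWe⟩ := exists_bilinBound_eq_traceNorm (Matrix.diagonal (fun i => √(r i)) * X *
      Matrix.diagonal (fun j => √(c j)))
    rw [weightedTraceNorm, ← hWe]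
    simp_rw [e]
    exact h W hW

lemma BilinBound.abs_apply_le {W : Matrix (Fin n) (Fin m) ℝ} (hW : BilinBound W 1) (i : Fin n)
    (j : Fin m) : |W i j| ≤ 1 := by
  have h1 := hW (Pi.single i 1) (Pi.single j 1)
  have h2 := hW (Pi.single i (-1)) (Pi.single j 1)
  simp [Pi.single_apply, ite_pow] at h1 h2
  rw [abs_le]
  constructor <;> linarith

lemma sqrt_le_one_of_mem_stdSimplex {r : Fin n → ℝ} (hr : r ∈ stdSimplex ℝ (Fin n)) (i : Fin n) :
    √(r i) ≤ 1 := by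
  rw [Real.sqrt_le_one]
  exact (mem_Icc_of_mem_stdSimplex hr i).2

lemma rcNorm_le_one_iff {R : Set (Fin n → ℝ)} {C : Set (Fin m → ℝ)}
    (hR : R ⊆ stdSimplex ℝ (Fin n)) (hC : C ⊆ stdSimplex ℝ (Fin m))
    {X : Matrix (Fin n) (Fin m) ℝ} :
    rcNorm R C X ≤ 1 ↔ ∀ r ∈ R, ∀ c ∈ C, ∀ W, BilinBound W 1 →
      ∑ i, ∑ j, √(r i) * X i j * √(c j) * W i j ≤ 1 := by
  simp_rw [← weightedTraceNorm_le_iff]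
  constructor
  · intro h r hr c hc
    -- An unbounded set would have `sSup = 0`, so boundedness must be shown.
    suffices hb : BddAbove {t : ℝ | ∃ r ∈ R, ∃ c ∈ C, t = weightedTraceNorm r c X} from
      (le_csSup hb ⟨r, hr, c, hc, rfl⟩).trans h
    refine ⟨∑ i, ∑ j, |X i j|, ?_⟩
    rintro t ⟨r, hr, c, hc, rfl⟩
    refine weightedTraceNorm_le_iff.2 fun W hW =>
      Finset.sum_le_sum fun i _ => Finset.sum_le_sum fun j _ => (le_abs_self _).trans ?_
    rw [abs_mul, abs_mul, abs_mul, abs_of_nonneg (Real.sqrt_nonneg _),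
      abs_of_nonneg (Real.sqrt_nonneg _)]
    have h1 := sqrt_le_one_of_mem_stdSimplex (hR hr) i
    have h2 := sqrt_le_one_of_mem_stdSimplex (hC hc) j
    calc √(r i) * |X i j| * √(c j) * |W i j| ≤ 1 * |X i j| * 1 * 1 := by
          gcongr
          exact hW.abs_apply_le i j
      _ = |X i j| := by ring
  · intro h
    refine Real.sSup_le ?_ zero_le_one
    rintro t ⟨r, hr, c, hc, rfl⟩
    exact h r hr c hc

end Duality

/-! ### The vector seminorms and the first inclusion -/

section VecNorm

variable {n m : ℕ} {R : Set (Fin n → ℝ)} {C : Set (Fin m → ℝ)}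

lemma sum_mul_sq_nonneg {r : Fin n → ℝ} (hr : r ∈ stdSimplex ℝ (Fin n)) (u : Fin n → ℝ) :
    0 ≤ ∑ i, r i * u i ^ 2 :=
  Finset.sum_nonneg fun i _ => mul_nonneg (hr.1 i) (sq_nonneg _)

lemma vecNorm_le_iff (hR : R ⊆ stdSimplex ℝ (Fin n)) {u : Fin n → ℝ} {s : ℝ} (hs : 0 ≤ s) :
    vecNorm R u ≤ s ↔ ∀ r ∈ R, ∑ i, r i * u i ^ 2 ≤ s ^ 2 := by
  rw [vecNorm, Real.sqrt_le_left hs]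
  constructor
  · intro h r hr
    suffices hb : BddAbove {t : ℝ | ∃ r ∈ R, t = ∑ i, r i * u i ^ 2} from
      (le_csSup hb ⟨r, hr, rfl⟩).trans h
    refine ⟨∑ i, u i ^ 2, ?_⟩
    rintro t ⟨r, hr, rfl⟩
    exact Finset.sum_le_sum fun i _ => mul_le_of_le_one_left (sq_nonneg _)
      (mem_Icc_of_mem_stdSimplex (hR hr) i).2
  · intro h
    refine Real.sSup_le ?_ (sq_nonneg s)
    rintro t ⟨r, hr, rfl⟩
    exact h r hr

lemma vecNorm_nonneg (R : Set (Fin n → ℝ)) (u : Fin n → ℝ) : 0 ≤ vecNorm R u := Real.sqrt_nonneg _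

lemma sum_mul_sq_le_vecNorm_sq (hR : R ⊆ stdSimplex ℝ (Fin n)) {r : Fin n → ℝ} (hr : r ∈ R)
    (u : Fin n → ℝ) : ∑ i, r i * u i ^ 2 ≤ vecNorm R u ^ 2 :=
  (vecNorm_le_iff hR (vecNorm_nonneg R u)).1 le_rfl r hr

lemma vecNorm_congr {u v : Fin n → ℝ}
    (h : ∀ r ∈ R, ∑ i, r i * u i ^ 2 = ∑ i, r i * v i ^ 2) : vecNorm R u = vecNorm R v := by
  have : {t : ℝ | ∃ r ∈ R, t = ∑ i, r i * u i ^ 2} =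
      {t : ℝ | ∃ r ∈ R, t = ∑ i, r i * v i ^ 2} := by
    ext t
    exact ⟨fun ⟨r, hr, e⟩ => ⟨r, hr, e.trans (h r hr)⟩,
      fun ⟨r, hr, e⟩ => ⟨r, hr, e.trans (h r hr).symm⟩⟩
  rw [vecNorm, vecNorm, this]

lemma vecNorm_smul_le (hR : R ⊆ stdSimplex ℝ (Fin n)) (a : ℝ) (u : Fin n → ℝ) :
    vecNorm R (a • u) ≤ |a| * vecNorm R u := by
  refine (vecNorm_le_iff hR (mul_nonneg (abs_nonneg _) (vecNorm_nonneg _ _))).2 fun r hr => ?_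
  have : ∑ i, r i * (a • u) i ^ 2 = a ^ 2 * ∑ i, r i * u i ^ 2 := by
    rw [Finset.mul_sum]
    refine Finset.sum_congr rfl fun i _ => ?_
    simp only [Pi.smul_apply, smul_eq_mul]
    ring
  rw [this, mul_pow, sq_abs]
  exact mul_le_mul_of_nonneg_left (sum_mul_sq_le_vecNorm_sq hR hr u) (sq_nonneg a)

lemma vecNorm_smul (hR : R ⊆ stdSimplex ℝ (Fin n)) (a : ℝ) (u : Fin n → ℝ) :
    vecNorm R (a • u) = |a| * vecNorm R u := by
  refine le_antisymm (vecNorm_smul_le hR a u) ?_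
  rcases eq_or_ne a 0 with rfl | ha
  · simpa using vecNorm_nonneg R 0
  · have h := vecNorm_smul_le hR a⁻¹ (a • u)
    rw [inv_smul_smul₀ ha, abs_inv] at h
    rwa [le_inv_mul_iff₀ (abs_pos.2 ha)] at h

lemma vecNorm_one (hR : R ⊆ stdSimplex ℝ (Fin n)) (hne : R.Nonempty) :
    vecNorm R 1 = 1 := by
  obtain ⟨r, hr⟩ := hne
  have h : ∀ r ∈ R, ∑ i, r i * (1 : Fin n → ℝ) i ^ 2 = 1 := fun r hr => by
    simpa using (hR hr).2
  refine le_antisymm ((vecNorm_le_iff hR zero_le_one).2 fun r hr => by rw [h r hr]; norm_num) ?_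
  have h2 := sum_mul_sq_le_vecNorm_sq hR hr 1
  rw [h r hr] at h2
  exact (one_le_sq_iff₀ (vecNorm_nonneg _ _)).1 h2

/-- A null vector has `r i * u i = 0` for all `r ∈ R` and all `i`, so it is invisible to every
weighted sum. -/
lemma vecNorm_add_of_eq_zero (hR : R ⊆ stdSimplex ℝ (Fin n)) {u : Fin n → ℝ}
    (hu : vecNorm R u = 0) (w : Fin n → ℝ) : vecNorm R (w + u) = vecNorm R w := by
  refine vecNorm_congr fun r hr => Finset.sum_congr rfl fun i _ => ?_
  have h1 := sum_mul_sq_le_vecNorm_sq hR hr u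
  rw [hu] at h1
  have h2 : r i * u i ^ 2 ≤ 0 := by
    refine le_trans ?_ (h1.trans (by norm_num))
    exact Finset.single_le_sum (f := fun i => r i * u i ^ 2)
      (fun i _ => mul_nonneg ((hR hr).1 i) (sq_nonneg _)) (Finset.mem_univ i)
  have h3 : r i * u i = 0 := by
    rcases eq_or_ne (u i) 0 with h | h
    · simp [h]
    · have : 0 < u i ^ 2 := by positivity
      have : r i = 0 := le_antisymm (by nlinarith) ((hR hr).1 i)
      simp [this]
  simp only [Pi.add_apply]
  linear_combination (2 * w i + u i) * h3

/-- If `s > 0`, `u` lies between `u / s` and `-u / s`. If `s = 0`, scaling fails, but `u` is the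
midpoint of `1 + u` and `-1 + u`, both of seminorm 1. This lets unit spheres be replaced by unit
balls in `rankOneHull_eq`. -/
lemma mem_convexHull_vecNorm_eq_one (hR : R ⊆ stdSimplex ℝ (Fin n)) (hne : R.Nonempty)
    {u : Fin n → ℝ} (hu : vecNorm R u ≤ 1) : u ∈ convexHull ℝ {w | vecNorm R w = 1} := by
  set s := vecNorm R u with hs
  have hneg : ∀ w, vecNorm R (-w) = vecNorm R w := fun w =>
    vecNorm_congr fun r _ => by simp
  rcases (vecNorm_nonneg R u).eq_or_lt with h0 | h0
  · have h1 : (1 + u : Fin n → ℝ) ∈ convexHull ℝ {w | vecNorm R w = 1} :=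
      subset_convexHull ℝ _ ((vecNorm_add_of_eq_zero hR h0.symm 1).trans (vecNorm_one hR hne))
    have h2 : (-1 + u : Fin n → ℝ) ∈ convexHull ℝ {w | vecNorm R w = 1} :=
      subset_convexHull ℝ _ ((vecNorm_add_of_eq_zero hR h0.symm (-1)).trans
        ((hneg 1).trans (vecNorm_one hR hne)))
    have := convex_convexHull ℝ {w | vecNorm R w = 1} h1 h2 (a := 1 / 2) (b := 1 / 2)
      (by norm_num) (by norm_num) (by norm_num)
    convert this using 1
    ext i
    simp
    ring
  · rw [← hs] at h0
    have h3 : vecNorm R (s⁻¹ • u) = 1 := by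
      rw [vecNorm_smul hR, abs_of_pos (inv_pos.2 h0), ← hs, inv_mul_cancel₀ h0.ne']
    have h1 : s⁻¹ • u ∈ convexHull ℝ {w | vecNorm R w = 1} := subset_convexHull ℝ _ h3
    have h2 : -(s⁻¹ • u) ∈ convexHull ℝ {w | vecNorm R w = 1} :=
      subset_convexHull ℝ _ ((hneg _).trans h3)
    have := convex_convexHull ℝ {w | vecNorm R w = 1} h1 h2 (a := (1 + s) / 2) (b := (1 - s) / 2)
      (by linarith) (by linarith) (by ring)
    convert this using 1
    ext i
    simp only [Pi.add_apply, Pi.smul_apply, Pi.neg_apply, smul_eq_mul]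
    field_simp
    ring

lemma vecMulVec_mem_convexHull {A : Set (Fin n → ℝ)} {B : Set (Fin m → ℝ)} {u : Fin n → ℝ}
    {v : Fin m → ℝ} (hu : u ∈ convexHull ℝ A) (hv : v ∈ convexHull ℝ B)
    {H : Set (Matrix (Fin n) (Fin m) ℝ)} (hH : Convex ℝ H)
    (h : ∀ a ∈ A, ∀ b ∈ B, Matrix.vecMulVec a b ∈ H) : Matrix.vecMulVec u v ∈ H := by
  have h1 : ∀ a ∈ A, Matrix.vecMulVec a v ∈ H := fun a ha => by
    have hc : Convex ℝ ((fun w => Matrix.vecMulVec a w) ⁻¹' H) :=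
      hH.is_linear_preimage ⟨fun x y => Matrix.vecMulVec_add a x y,
        fun c x => by ext; simp [Matrix.vecMulVec_apply, mul_left_comm]⟩
    exact convexHull_min (fun b hb => h a ha b hb) hc hv
  have hc : Convex ℝ ((fun w => Matrix.vecMulVec w v) ⁻¹' H) :=
    hH.is_linear_preimage ⟨fun x y => Matrix.add_vecMulVec x y v,
      fun c x => Matrix.smul_vecMulVec c x v⟩
  exact convexHull_min h1 hc hu

lemma rankOneHull_eq (hR : R ⊆ stdSimplex ℝ (Fin n)) (hC : C ⊆ stdSimplex ℝ (Fin m))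
    (hRne : R.Nonempty) (hCne : C.Nonempty) :
    rankOneHull R C = convexHull ℝ {X | ∃ (u : Fin n → ℝ) (v : Fin m → ℝ),
      vecNorm R u ≤ 1 ∧ vecNorm C v ≤ 1 ∧ X = Matrix.vecMulVec u v} := by
  refine Set.Subset.antisymm (convexHull_mono ?_) (convexHull_min ?_ (convex_convexHull ℝ _))
  · rintro X ⟨u, v, hu, hv, rfl⟩
    exact ⟨u, v, hu.le, hv.le, rfl⟩
  · rintro X ⟨u, v, hu, hv, rfl⟩
    exact vecMulVec_mem_convexHull (mem_convexHull_vecNorm_eq_one hR hRne hu)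
      (mem_convexHull_vecNorm_eq_one hC hCne hv) (convex_convexHull ℝ _)
      fun a ha b hb => subset_convexHull ℝ _ ⟨a, b, ha, hb, rfl⟩

lemma convex_rcNorm_le_one (hR : R ⊆ stdSimplex ℝ (Fin n)) (hC : C ⊆ stdSimplex ℝ (Fin m)) :
    Convex ℝ {X | rcNorm R C X ≤ 1} := by
  intro X hX Z hZ a b ha hb hab
  rw [Set.mem_ofPred_eq, rcNorm_le_one_iff hR hC] at hX hZ ⊢
  intro r hr c hc W hW
  have e : ∑ i, ∑ j, √(r i) * (a • X + b • Z) i j * √(c j) * W i j =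
      a * ∑ i, ∑ j, √(r i) * X i j * √(c j) * W i j +
      b * ∑ i, ∑ j, √(r i) * Z i j * √(c j) * W i j := by
    simp only [Finset.mul_sum, ← Finset.sum_add_distrib]
    refine Finset.sum_congr rfl fun i _ => Finset.sum_congr rfl fun j _ => ?_
    simp only [Matrix.add_apply, Matrix.smul_apply, smul_eq_mul]
    ring
  rw [e]
  have h1 := mul_le_mul_of_nonneg_left (hX r hr c hc W hW) ha
  have h2 := mul_le_mul_of_nonneg_left (hZ r hr c hc W hW) hb
  linarith

lemma rankOneHull_subset (hR : R ⊆ stdSimplex ℝ (Fin n)) (hC : C ⊆ stdSimplex ℝ (Fin m)) :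
    rankOneHull R C ⊆ {X | rcNorm R C X ≤ 1} := by
  refine convexHull_min ?_ (convex_rcNorm_le_one hR hC)
  rintro X ⟨u, v, hu, hv, rfl⟩
  rw [Set.mem_ofPred_eq, rcNorm_le_one_iff hR hC]
  intro r hr c hc W hW
  have h := hW (fun i => √(r i) * u i) (fun j => √(c j) * v j)
  have h1 := sum_mul_sq_le_vecNorm_sq hR hr u
  have h2 := sum_mul_sq_le_vecNorm_sq hC hc v
  have e1 : ∑ i, (√(r i) * u i) ^ 2 = ∑ i, r i * u i ^ 2 :=
    Finset.sum_congr rfl fun i _ => by rw [mul_pow, Real.sq_sqrt ((hR hr).1 i)]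
  have e2 : ∑ j, (√(c j) * v j) ^ 2 = ∑ j, c j * v j ^ 2 :=
    Finset.sum_congr rfl fun j _ => by rw [mul_pow, Real.sq_sqrt ((hC hc).1 j)]
  have e3 : ∑ i, ∑ j, √(r i) * Matrix.vecMulVec u v i j * √(c j) * W i j =
      ∑ i, ∑ j, √(r i) * u i * W i j * (√(c j) * v j) :=
    Finset.sum_congr rfl fun i _ => Finset.sum_congr rfl fun j _ => by
      rw [Matrix.vecMulVec_apply]
      ring
  rw [hu] at h1
  rw [hv] at h2
  rw [e1, e2] at h
  rw [e3]
  linarith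

end VecNorm

/-! ### Pietsch domination and the duality bound -/

section Factorization

variable {n m : ℕ} {R : Set (Fin n → ℝ)} {C : Set (Fin m → ℝ)}

lemma locallyConvexSpace_matrix (ι κ : Type*) : LocallyConvexSpace ℝ (Matrix ι κ ℝ) :=
  inferInstanceAs (LocallyConvexSpace ℝ (ι → κ → ℝ))

lemma map_eq_sum_single {ι κ : Type*} [Fintype ι] [Fintype κ] [DecidableEq ι] [DecidableEq κ]
    (f : Matrix ι κ ℝ →L[ℝ] ℝ) (M : Matrix ι κ ℝ) :
    f M = ∑ a, ∑ b, M a b * f (Matrix.single a b 1) := by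
  conv_lhs => rw [Matrix.matrix_eq_sum_single M]
  simp only [map_sum]
  refine Finset.sum_congr rfl fun a _ => Finset.sum_congr rfl fun b _ => ?_
  rw [← smul_eq_mul, ← map_smul, Matrix.smul_single, smul_eq_mul, mul_one]

/-- A real positive semidefinite matrix is a Gram matrix. -/
lemma exists_gram_eq {ι : Type*} [Fintype ι] {M : Matrix ι ι ℝ} (hM : M.PosSemidef) :
    ∃ w : ι → EuclideanSpace ℝ ι, ∀ a b, inner ℝ (w a) (w b) = M a b := by
  classical
  open scoped MatrixOrder in
  obtain ⟨B, rfl⟩ := CStarAlgebra.nonneg_iff_eq_star_mul_self.1 hM.nonneg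
  refine ⟨fun a => WithLp.toLp 2 fun k => B k a, fun a b => ?_⟩
  simp [PiLp.inner_apply, Matrix.mul_apply, Matrix.star_apply, mul_comm]

lemma vecNorm_mono (hR : R ⊆ stdSimplex ℝ (Fin n)) {u v : Fin n → ℝ} (h : ∀ i, |u i| ≤ |v i|) :
    vecNorm R u ≤ vecNorm R v :=
  (vecNorm_le_iff hR (vecNorm_nonneg _ _)).2 fun _ hr =>
    (Finset.sum_le_sum fun i _ => mul_le_mul_of_nonneg_left (sq_le_sq.2 (h i))
      ((hR hr).1 i)).trans (sum_mul_sq_le_vecNorm_sq hR hr v)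

lemma bilin_le_vecNorm_mul (hR : R ⊆ stdSimplex ℝ (Fin n)) (hC : C ⊆ stdSimplex ℝ (Fin m))
    {Y : Matrix (Fin n) (Fin m) ℝ}
    (hY : ∀ u v, vecNorm R u ≤ 1 → vecNorm C v ≤ 1 → ∑ i, ∑ j, Y i j * (u i * v j) ≤ 1)
    (u : Fin n → ℝ) (v : Fin m → ℝ) :
    ∑ i, ∑ j, Y i j * (u i * v j) ≤ vecNorm R u * vecNorm C v := by
  -- The seminorms may vanish, so normalise by `‖u‖ + ε`, `‖v‖ + ε` and let `ε → 0`.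
  have hlim : Filter.Tendsto (fun ε : ℝ => (vecNorm R u + ε) * (vecNorm C v + ε))
      (nhdsWithin 0 (Set.Ioi 0)) (nhds (vecNorm R u * vecNorm C v)) := by
    have : Continuous fun ε : ℝ => (vecNorm R u + ε) * (vecNorm C v + ε) := by fun_prop
    have h := (this.tendsto 0).mono_left (nhdsWithin_le_nhds (s := Set.Ioi 0))
    simpa using h
  refine ge_of_tendsto hlim (Filter.eventually_of_mem self_mem_nhdsWithin fun ε hε => ?_)
  have hε : 0 < ε := hε
  have hs : 0 < vecNorm R u + ε := add_pos_of_nonneg_of_pos (vecNorm_nonneg _ _) hε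
  have ht : 0 < vecNorm C v + ε := add_pos_of_nonneg_of_pos (vecNorm_nonneg _ _) hε
  have h := hY ((vecNorm R u + ε)⁻¹ • u) ((vecNorm C v + ε)⁻¹ • v)
    (by
      rw [vecNorm_smul hR, abs_of_pos (inv_pos.2 hs), inv_mul_le_one₀ hs]
      linarith)
    (by
      rw [vecNorm_smul hC, abs_of_pos (inv_pos.2 ht), inv_mul_le_one₀ ht]
      linarith)
  have e : ∑ i, ∑ j, Y i j * (((vecNorm R u + ε)⁻¹ • u) i * ((vecNorm C v + ε)⁻¹ • v) j) =
      ((vecNorm R u + ε) * (vecNorm C v + ε))⁻¹ * ∑ i, ∑ j, Y i j * (u i * v j) := by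
    simp only [Finset.mul_sum, Pi.smul_apply, smul_eq_mul, mul_inv]
    refine Finset.sum_congr rfl fun i _ => Finset.sum_congr rfl fun j _ => ?_
    ring
  rwa [e, inv_mul_le_one₀ (mul_pos hs ht)] at h

/-- Grothendieck's inequality for the pair of seminorms `‖·‖_R`, `‖·‖_C`. -/
lemma GrothendieckInequality.inner_le {K : ℝ} (hK : GrothendieckInequality K)
    (hR : R ⊆ stdSimplex ℝ (Fin n)) (hC : C ⊆ stdSimplex ℝ (Fin m))
    {Y : Matrix (Fin n) (Fin m) ℝ}
    (hY : ∀ u v, vecNorm R u ≤ 1 → vecNorm C v ≤ 1 → ∑ i, ∑ j, Y i j * (u i * v j) ≤ 1)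
    {E : Type*} [NormedAddCommGroup E] [InnerProductSpace ℝ E] [FiniteDimensional ℝ E]
    (U : Fin n → E) (V : Fin m → E) :
    ∑ i, ∑ j, Y i j * inner ℝ (U i) (V j) ≤
      K * (vecNorm R (fun i => ‖U i‖) * vecNorm C (fun j => ‖V j‖)) := by
  let φ := (stdOrthonormalBasis ℝ E).repr
  have hunit : ∀ w : E, ‖φ (‖w‖⁻¹ • w)‖ ≤ 1 := fun w => by
    rw [LinearIsometryEquiv.norm_map, norm_smul, norm_inv, norm_norm]
    exact inv_mul_le_one
  have hscale : ∀ w : E, ‖w‖ • (‖w‖⁻¹ • w) = w := fun w => by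
    rcases eq_or_ne w 0 with rfl | h
    · simp
    · exact smul_inv_smul₀ (norm_ne_zero_iff.2 h) w
  -- The lengths move into the matrix; in the scalar supremum they then multiply `u` and `v`.
  have h := hK n m _ (Matrix.of fun i j => Y i j * (‖U i‖ * ‖V j‖))
    (fun i => φ (‖U i‖⁻¹ • U i)) (fun j => φ (‖V j‖⁻¹ • V j)) (fun i => hunit _) fun j => hunit _
  have e : ∀ i j, Y i j * (‖U i‖ * ‖V j‖) * inner ℝ (φ (‖U i‖⁻¹ • U i)) (φ (‖V j‖⁻¹ • V j)) =
      Y i j * inner ℝ (U i) (V j) := fun i j => by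
    rw [LinearIsometryEquiv.inner_map_map]
    conv_rhs => rw [← hscale (U i), ← hscale (V j), real_inner_smul_left, real_inner_smul_right]
    ring
  simp only [Matrix.of_apply, e] at h
  refine h.trans (mul_le_mul_of_nonneg_left ?_ (zero_le_one.trans hK.one_le))
  refine Real.sSup_le ?_ (mul_nonneg (vecNorm_nonneg _ _) (vecNorm_nonneg _ _))
  rintro t ⟨u, v, hu, hv, rfl⟩
  have h1 := bilin_le_vecNorm_mul hR hC hY (fun i => ‖U i‖ * u i) (fun j => ‖V j‖ * v j)
  have e1 : ∑ i, ∑ j, Y i j * (‖U i‖ * ‖V j‖) * (u i * v j) =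
      ∑ i, ∑ j, Y i j * (‖U i‖ * u i * (‖V j‖ * v j)) :=
    Finset.sum_congr rfl fun i _ => Finset.sum_congr rfl fun j _ => by ring
  rw [e1]
  refine h1.trans (mul_le_mul (vecNorm_mono hR fun i => ?_) (vecNorm_mono hC fun j => ?_)
    (vecNorm_nonneg _ _) (vecNorm_nonneg _ _))
  · rw [abs_mul]
    exact mul_le_of_le_one_right (abs_nonneg _) (hu i)
  · rw [abs_mul]
    exact mul_le_of_le_one_right (abs_nonneg _) (hv j)

lemma isClosed_quadraticForm_nonneg (ι : Type*) [Fintype ι] :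
    IsClosed {M : Matrix ι ι ℝ | ∀ x : ι → ℝ, 0 ≤ ∑ a, ∑ b, x a * M a b * x b} := by
  simp only [Set.ofPred_forall]
  refine isClosed_iInter fun x => isClosed_le continuous_const ?_
  exact continuous_finsetSum _ fun a _ => continuous_finsetSum _ fun b _ =>
    (continuous_const.mul (continuous_id.matrix_elem a b)).mul continuous_const

lemma convex_quadraticForm_nonneg (ι : Type*) [Fintype ι] :
    Convex ℝ {M : Matrix ι ι ℝ | ∀ x : ι → ℝ, 0 ≤ ∑ a, ∑ b, x a * M a b * x b} := by
  intro M hM N hN s t hs ht _ x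
  have e : ∑ a, ∑ b, x a * (s • M + t • N) a b * x b =
      s * ∑ a, ∑ b, x a * M a b * x b + t * ∑ a, ∑ b, x a * N a b * x b := by
    simp only [Finset.mul_sum, ← Finset.sum_add_distrib]
    refine Finset.sum_congr rfl fun a _ => Finset.sum_congr rfl fun b _ => ?_
    simp only [Matrix.add_apply, Matrix.smul_apply, smul_eq_mul]
    ring
  rw [e]
  exact add_nonneg (mul_nonneg hs (hM x)) (mul_nonneg ht (hN x))

/-- A linear functional bounded below on the matrices with nonnegative quadratic form is
the pairing with a Gram matrix. -/
lemma exists_gram_of_bddBelow {ι : Type*} [Fintype ι] [DecidableEq ι] (f : Matrix ι ι ℝ →L[ℝ] ℝ)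
    {v : ℝ} (hf : ∀ M : Matrix ι ι ℝ, (∀ x : ι → ℝ, 0 ≤ ∑ a, ∑ b, x a * M a b * x b) → v < f M) :
    ∃ w : ι → EuclideanSpace ℝ ι, ∀ M, f M = ∑ a, ∑ b, M a b * inner ℝ (w a) (w b) := by
  -- A negative value could be scaled to exactly `v`, contradicting the strict bound.
  have hnn : ∀ M : Matrix ι ι ℝ, (∀ x : ι → ℝ, 0 ≤ ∑ a, ∑ b, x a * M a b * x b) → 0 ≤ f M := by
    intro M hM
    by_contra! hneg
    have hv : v < 0 := by simpa using hf 0 (by simp)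
    have hpos : 0 ≤ v / f M := (div_pos_of_neg_of_neg hv hneg).le
    have := hf ((v / f M) • M) fun x => by
      have e : ∑ a, ∑ b, x a * ((v / f M) • M) a b * x b =
          v / f M * ∑ a, ∑ b, x a * M a b * x b := by
        simp only [Finset.mul_sum, Matrix.smul_apply, smul_eq_mul]
        refine Finset.sum_congr rfl fun a _ => Finset.sum_congr rfl fun b _ => ?_
        ring
      rw [e]
      exact mul_nonneg hpos (hM x)
    rw [map_smul, smul_eq_mul, div_mul_cancel₀ _ hneg.ne] at this
    exact lt_irrefl _ this
  -- The cone contains nonsymmetric matrices: the difference of the two units has zero quadratic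
  -- form. This forces symmetric coefficients.
  have hle : ∀ a b, f (Matrix.single a b 1) ≤ f (Matrix.single b a 1) := fun a b => by
    rw [← sub_nonneg, ← map_sub]
    refine hnn _ fun x => le_of_eq ?_
    simp only [Matrix.sub_apply, mul_sub, sub_mul, Finset.sum_sub_distrib]
    have e : ∀ a b, ∑ p, ∑ q, x p * Matrix.single a b (1 : ℝ) p q * x q = x a * x b :=
      fun a b => by
        rw [Finset.sum_eq_single a, Finset.sum_eq_single b]
        · simp
        · intro q _ hq
          simp [hq.symm]
        · simp
        · intro p _ hp
          simp [hp.symm]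
        · simp
    rw [e, e]
    ring
  have hg : (Matrix.of fun a b => f (Matrix.single a b 1)).PosSemidef := by
    refine (posSemidef_iff_sum (M := Matrix.of fun a b => f (Matrix.single a b 1))
      fun a b => le_antisymm (hle a b) (hle b a)).2 fun x => ?_
    have h1 := hnn (Matrix.vecMulVec x x) fun z => by
      have : ∑ a, ∑ b, z a * Matrix.vecMulVec x x a b * z b =
          (∑ a, z a * x a) * ∑ b, z b * x b := by
        rw [Finset.sum_mul_sum]
        refine Finset.sum_congr rfl fun a _ => Finset.sum_congr rfl fun b _ => ?_
        rw [Matrix.vecMulVec_apply]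
        ring
      rw [this]
      exact mul_self_nonneg _
    rw [map_eq_sum_single] at h1
    refine h1.trans_eq (Finset.sum_congr rfl fun a _ => Finset.sum_congr rfl fun b _ => ?_)
    rw [Matrix.vecMulVec_apply, Matrix.of_apply]
    ring
  obtain ⟨w, hw⟩ := exists_gram_eq hg
  refine ⟨w, fun M => ?_⟩
  rw [map_eq_sum_single]
  simp only [hw, Matrix.of_apply]

/-- Pietsch-type domination: the bilinear form of `Y` is dominated by the quadratic forms of a single
pair of weights. -/
lemma GrothendieckInequality.exists_weights {K : ℝ} (hK : GrothendieckInequality K)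
    (hR : R ⊆ stdSimplex ℝ (Fin n)) (hC : C ⊆ stdSimplex ℝ (Fin m))
    (hRconv : Convex ℝ R) (hCconv : Convex ℝ C) (hRne : R.Nonempty) (hCne : C.Nonempty)
    {Y : Matrix (Fin n) (Fin m) ℝ}
    (hY : ∀ u v, vecNorm R u ≤ 1 → vecNorm C v ≤ 1 → ∑ i, ∑ j, Y i j * (u i * v j) ≤ 1) :
    ∃ r ∈ closure R, ∃ c ∈ closure C, ∀ (x : Fin n → ℝ) (y : Fin m → ℝ),
      2 * ∑ i, ∑ j, Y i j * (x i * y j) ≤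
        K * (∑ i, r i * x i ^ 2 + ∑ j, c j * y j ^ 2) := by
  have hK0 : 0 < K := zero_lt_one.trans_le hK.one_le
  set B : Matrix (Fin n ⊕ Fin m) (Fin n ⊕ Fin m) ℝ := Matrix.fromBlocks 0 Y Y.transpose 0 with hB
  -- The weights `p` dominate `Y` exactly when `Φ p` has nonnegative quadratic form. If no `p` does,
  -- the compact convex image of `Φ` misses that cone and can be separated from it.
  set Φ : (Fin n → ℝ) × (Fin m → ℝ) → Matrix (Fin n ⊕ Fin m) (Fin n ⊕ Fin m) ℝ := fun p =>
    K • Matrix.diagonal (Sum.elim p.1 p.2) - B with hΦ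
  have hpair : ∀ (p : (Fin n → ℝ) × (Fin m → ℝ)) (g : Fin n ⊕ Fin m → Fin n ⊕ Fin m → ℝ),
      (∀ a b, g a b = g b a) → ∑ a, ∑ b, Φ p a b * g a b =
        K * (∑ i, p.1 i * g (Sum.inl i) (Sum.inl i) + ∑ j, p.2 j * g (Sum.inr j) (Sum.inr j)) -
        2 * ∑ i, ∑ j, Y i j * g (Sum.inl i) (Sum.inr j) := fun p g hg => by
    have hc : ∑ j, ∑ i, Y i j * g (Sum.inr j) (Sum.inl i) =
        ∑ i, ∑ j, Y i j * g (Sum.inl i) (Sum.inr j) := by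
      rw [Finset.sum_comm]
      simp_rw [hg (Sum.inr _) (Sum.inl _)]
    simp only [hΦ, hB, Fintype.sum_sum_type, Matrix.sub_apply, Matrix.smul_apply, smul_eq_mul,
      Matrix.diagonal_apply, Matrix.fromBlocks_apply₁₁, Matrix.fromBlocks_apply₁₂,
      Matrix.fromBlocks_apply₂₁, Matrix.fromBlocks_apply₂₂, Matrix.zero_apply,
      Matrix.transpose_apply, Sum.inl.injEq, Sum.inr.injEq, reduceCtorEq, if_false, mul_zero,
      sub_zero, zero_sub, mul_ite, ite_mul, zero_mul, Finset.sum_ite_eq, Finset.mem_univ, if_true,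
      Sum.elim_inl, Sum.elim_inr, neg_mul, Finset.sum_neg_distrib, Finset.sum_add_distrib, hc,
      mul_assoc, ← Finset.mul_sum]
    ring
  have hcont : Continuous Φ := by
    suffices hd : Continuous fun p : (Fin n → ℝ) × (Fin m → ℝ) => Sum.elim p.1 p.2 from
      (hd.matrix_diagonal.const_smul K).sub continuous_const
    refine continuous_pi ?_
    rintro (i | j)
    · exact (continuous_apply i).comp continuous_fst
    · exact (continuous_apply j).comp continuous_snd
  by_contra! hno
  have hcompact : IsCompact (Φ '' (closure R ×ˢ closure C)) := by
    refine IsCompact.image (IsCompact.prod ?_ ?_) hcont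
    · exact (isCompact_stdSimplex ℝ (Fin n)).of_isClosed_subset isClosed_closure
        (closure_minimal hR (isClosed_stdSimplex ℝ (Fin n)))
    · exact (isCompact_stdSimplex ℝ (Fin m)).of_isClosed_subset isClosed_closure
        (closure_minimal hC (isClosed_stdSimplex ℝ (Fin m)))
  have hconv : Convex ℝ (Φ '' (closure R ×ˢ closure C)) := by
    rintro _ ⟨p, hp, rfl⟩ _ ⟨q, hq, rfl⟩ s t hs ht hst
    refine ⟨s • p + t • q, (hRconv.closure.prod hCconv.closure) hp hq hs ht hst, ?_⟩
    ext a b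
    have : B a b = s * B a b + t * B a b := by rw [← add_mul, hst, one_mul]
    simp only [hΦ, Matrix.sub_apply, Matrix.add_apply, Matrix.smul_apply, smul_eq_mul,
      Matrix.diagonal_apply]
    split_ifs with h
    · rcases a with i | j <;> simp <;> linear_combination -this
    · linear_combination -this
  have hdisj : Disjoint (Φ '' (closure R ×ˢ closure C))
      {M | ∀ x : Fin n ⊕ Fin m → ℝ, 0 ≤ ∑ a, ∑ b, x a * M a b * x b} := by
    rw [Set.disjoint_left]
    rintro _ ⟨p, hp, rfl⟩ hM
    obtain ⟨x, y, hxy⟩ := hno p.1 hp.1 p.2 hp.2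
    have h1 := hM (Sum.elim x y)
    have h2 := hpair p (fun a b => Sum.elim x y a * Sum.elim x y b) fun a b => mul_comm _ _
    have e : ∑ a, ∑ b, Sum.elim x y a * Φ p a b * Sum.elim x y b =
        ∑ a, ∑ b, Φ p a b * (Sum.elim x y a * Sum.elim x y b) :=
      Finset.sum_congr rfl fun a _ => Finset.sum_congr rfl fun b _ => by ring
    rw [e, h2] at h1
    simp only [Sum.elim_inl, Sum.elim_inr, ← sq] at h1
    linarith
  have := locallyConvexSpace_matrix (Fin n ⊕ Fin m) (Fin n ⊕ Fin m)
  obtain ⟨f, u, v, hfu, huv, hfv⟩ := geometric_hahn_banach_compact_closed hconv hcompact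
    (convex_quadraticForm_nonneg _) (isClosed_quadraticForm_nonneg _) hdisj
  obtain ⟨w, hw⟩ := exists_gram_of_bddBelow f hfv
  have hv0 : v < 0 := by simpa using hfv 0 (by simp)
  have hG := hK.inner_le hR hC hY (fun i => w (Sum.inl i)) fun j => w (Sum.inr j)
  set s := vecNorm R fun i => ‖w (Sum.inl i)‖
  set t := vecNorm C fun j => ‖w (Sum.inr j)‖
  set Z := ∑ i, ∑ j, Y i j * inner ℝ (w (Sum.inl i)) (w (Sum.inr j))
  have hlt : ∀ r ∈ R, ∀ c ∈ C, K * (∑ i, r i * ‖w (Sum.inl i)‖ ^ 2 +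
      ∑ j, c j * ‖w (Sum.inr j)‖ ^ 2) ≤ u + 2 * Z := fun r hr c hc => by
    have h1 := hfu _ ⟨(r, c), ⟨subset_closure hr, subset_closure hc⟩, rfl⟩
    rw [hw, hpair _ (fun a b => inner ℝ (w a) (w b)) fun a b => real_inner_comm _ _] at h1
    simp only [real_inner_self_eq_norm_sq] at h1
    linarith
  have hsup : ∀ {k : ℕ} {P : Set (Fin k → ℝ)}, P ⊆ stdSimplex ℝ (Fin k) → P.Nonempty →
      ∀ {a : Fin k → ℝ} {z : ℝ}, (∀ p ∈ P, ∑ i, p i * a i ^ 2 ≤ z) → vecNorm P a ^ 2 ≤ z := by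
    intro k P hP ⟨p, hp⟩ a z h
    have hz : 0 ≤ z := (sum_mul_sq_nonneg (hP hp) a).trans (h p hp)
    have := (vecNorm_le_iff hP (Real.sqrt_nonneg z)).2 fun q hq => by
      rw [Real.sq_sqrt hz]
      exact h q hq
    rw [← Real.sq_sqrt hz]
    exact pow_le_pow_left₀ (vecNorm_nonneg _ _) this 2
  -- Supremum over `r` with `c` fixed, then over `c`.
  have hs : ∀ c ∈ C, s ^ 2 ≤ (u + 2 * Z) / K - ∑ j, c j * ‖w (Sum.inr j)‖ ^ 2 := fun c hc =>
    hsup hR hRne fun r hr => by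
      rw [le_sub_iff_add_le, le_div_iff₀ hK0, mul_comm]
      exact hlt r hr c hc
  have ht : t ^ 2 ≤ (u + 2 * Z) / K - s ^ 2 := hsup hC hCne fun c hc => by linarith [hs c hc]
  rw [le_sub_iff_add_le, le_div_iff₀ hK0] at ht
  -- `K (s² + t²) ≤ u + 2Z ≤ u + 2Kst` with `u < v < 0` would give `K (s - t)² < 0`.
  nlinarith [mul_nonneg hK0.le (sq_nonneg (s - t))]

lemma eq_zero_of_forall_le {a b : ℝ} (h : ∀ t : ℝ, a * t ≤ b) : a = 0 := by
  by_contra ha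
  have := h ((b + 1) / a)
  rw [mul_div_cancel₀ _ ha] at this
  linarith

/-- The duality bound behind the second inclusion. -/
lemma GrothendieckInequality.sum_mul_le {K : ℝ} (hK : GrothendieckInequality K)
    (hR : R ⊆ stdSimplex ℝ (Fin n)) (hC : C ⊆ stdSimplex ℝ (Fin m))
    (hRconv : Convex ℝ R) (hCconv : Convex ℝ C) (hRne : R.Nonempty) (hCne : C.Nonempty)
    {X Y : Matrix (Fin n) (Fin m) ℝ} (hX : rcNorm R C X ≤ 1)
    (hY : ∀ u v, vecNorm R u ≤ 1 → vecNorm C v ≤ 1 → ∑ i, ∑ j, Y i j * (u i * v j) ≤ 1) :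
    ∑ i, ∑ j, X i j * Y i j ≤ K := by
  have hK0 : 0 < K := zero_lt_one.trans_le hK.one_le
  obtain ⟨r, hr, c, hc, hrc⟩ := hK.exists_weights hR hC hRconv hCconv hRne hCne hY
  have hr0 : ∀ i, 0 ≤ r i := (closure_minimal hR (isClosed_stdSimplex ℝ (Fin n)) hr).1
  have hc0 : ∀ j, 0 ≤ c j := (closure_minimal hC (isClosed_stdSimplex ℝ (Fin m)) hc).1
  have hsingle : ∀ i j (x y : ℝ), 2 * (Y i j * (x * y)) ≤ K * (r i * x ^ 2 + c j * y ^ 2) := by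
    intro i j x y
    have h := hrc (Pi.single i x) (Pi.single j y)
    simpa [Pi.single_apply, ite_pow] using h
  -- With `r i = 0` a linear function of `t` stays bounded above. So dividing by `√(r i)` below
  -- loses nothing.
  have hYr : ∀ i j, r i = 0 → Y i j = 0 := fun i j h0 =>
    eq_zero_of_forall_le (b := K * c j / 2) fun t => by
      have := hsingle i j t 1
      rw [h0] at this
      linarith
  have hYc : ∀ i j, c j = 0 → Y i j = 0 := fun i j h0 =>
    eq_zero_of_forall_le (b := K * r i / 2) fun t => by
      have := hsingle i j 1 t
      rw [h0] at this
      linarith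
  set W : Matrix (Fin n) (Fin m) ℝ := Matrix.of fun i j => K⁻¹ * (Y i j / (√(r i) * √(c j)))
  have hW : BilinBound W 1 := by
    intro x y
    have h := hrc (fun i => x i / √(r i)) fun j => y j / √(c j)
    have e : ∑ i, ∑ j, x i * W i j * y j =
        K⁻¹ * ∑ i, ∑ j, Y i j * (x i / √(r i) * (y j / √(c j))) := by
      simp only [Finset.mul_sum, W, Matrix.of_apply]
      refine Finset.sum_congr rfl fun i _ => Finset.sum_congr rfl fun j _ => ?_
      simp only [div_eq_mul_inv, mul_inv]
      ring
    have hle : ∀ a p : ℝ, 0 ≤ p → p * (a / √p) ^ 2 ≤ a ^ 2 := fun a p hp => by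
      rcases hp.eq_or_lt with h0 | h0
      · rw [← h0]
        simpa using sq_nonneg a
      · rw [div_pow, Real.sq_sqrt hp, mul_div_cancel₀ _ h0.ne']
    have h1 : ∑ i, r i * (x i / √(r i)) ^ 2 ≤ ∑ i, x i ^ 2 :=
      Finset.sum_le_sum fun i _ => hle _ _ (hr0 i)
    have h2 : ∑ j, c j * (y j / √(c j)) ^ 2 ≤ ∑ j, y j ^ 2 :=
      Finset.sum_le_sum fun j _ => hle _ _ (hc0 j)
    rw [e, one_mul, mul_left_comm, inv_mul_le_iff₀ hK0]
    exact h.trans (mul_le_mul_of_nonneg_left (add_le_add h1 h2) hK0.le)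
  -- The hypothesis on `X` concerns `R × C`, but the weights lie in the closures; the inequality
  -- passes to the limit.
  have hclosed : IsClosed {p : (Fin n → ℝ) × (Fin m → ℝ) |
      ∑ i, ∑ j, √(p.1 i) * X i j * √(p.2 j) * W i j ≤ 1} :=
    isClosed_le (by fun_prop) continuous_const
  have hsub : closure (R ×ˢ C) ⊆ {p : (Fin n → ℝ) × (Fin m → ℝ) |
      ∑ i, ∑ j, √(p.1 i) * X i j * √(p.2 j) * W i j ≤ 1} :=
    closure_minimal (fun p hp => (rcNorm_le_one_iff hR hC).1 hX p.1 hp.1 p.2 hp.2 W hW) hclosed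
  rw [closure_prod_eq] at hsub
  have h : ∑ i, ∑ j, √(r i) * X i j * √(c j) * W i j ≤ 1 := hsub (Set.mk_mem_prod hr hc)
  have e : ∑ i, ∑ j, √(r i) * X i j * √(c j) * W i j = K⁻¹ * ∑ i, ∑ j, X i j * Y i j := by
    simp only [Finset.mul_sum, W, Matrix.of_apply]
    refine Finset.sum_congr rfl fun i _ => Finset.sum_congr rfl fun j _ => ?_
    by_cases h1 : r i = 0
    · simp [hYr i j h1]
    by_cases h2 : c j = 0
    · simp [hYc i j h2]
    have h3 : √(r i) ≠ 0 := (Real.sqrt_pos.2 ((hr0 i).lt_of_ne' h1)).ne'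
    have h4 : √(c j) ≠ 0 := (Real.sqrt_pos.2 ((hc0 j).lt_of_ne' h2)).ne'
    field_simp
  rw [e, inv_mul_le_iff₀ hK0, mul_one] at h
  exact h

end Factorization

/-! ### Topology of the hull and the second inclusion -/

/-- By Carathéodory, `dim E + 1` points suffice, so the hull is a finite union of continuous images
of compact sets. -/
lemma isCompact_convexHull {E : Type*} [AddCommGroup E] [Module ℝ E] [FiniteDimensional ℝ E]
    [TopologicalSpace E] [ContinuousAdd E] [ContinuousSMul ℝ E] {s : Set E} (hs : IsCompact s) :
    IsCompact (convexHull ℝ s) := by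
  have heq : convexHull ℝ s = ⋃ k ∈ Set.Iic (Module.finrank ℝ E + 1),
      (fun p : (Fin k → ℝ) × (Fin k → E) => ∑ i, p.1 i • p.2 i) ''
        (stdSimplex ℝ (Fin k) ×ˢ Set.pi Set.univ fun _ => s) := by
    ext x
    simp only [Set.mem_iUnion, Set.mem_image, Set.mem_prod, Set.mem_pi, Prod.exists, Set.mem_Iic]
    constructor
    · intro hx
      obtain ⟨ι, _, z, w, hz, hai, hw, hw1, rfl⟩ := eq_pos_convex_span_of_mem_convexHull hx
      have e := Fintype.equivFin ι
      refine ⟨Fintype.card ι, hai.card_le_finrank_succ.trans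
        (Nat.succ_le_succ (Submodule.finrank_le _)), w ∘ e.symm, z ∘ e.symm,
        ⟨⟨fun i => (hw _).le, ?_⟩, fun i _ => hz (Set.mem_range_self _)⟩, ?_⟩
      · rw [← hw1]
        exact e.symm.sum_comp w
      · exact e.symm.sum_comp fun i => w i • z i
    · rintro ⟨k, -, w, z, ⟨hw, hz⟩, rfl⟩
      exact (convex_convexHull ℝ s).sum_mem (fun i _ => hw.1 i) hw.2
        fun i _ => subset_convexHull ℝ s (hz i trivial)
  rw [heq]
  refine (Set.finite_Iic _).isCompact_biUnion fun k _ => IsCompact.image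
    ((isCompact_stdSimplex ℝ (Fin k)).prod (isCompact_univ_pi fun _ => hs)) ?_
  exact continuous_finsetSum _ fun i _ => ((continuous_apply i).comp continuous_fst).smul
    ((continuous_apply i).comp continuous_snd)

section Inclusion

variable {n m : ℕ} {R : Set (Fin n → ℝ)} {C : Set (Fin m → ℝ)}

lemma isCompact_vecNorm_le_one (hR : R ⊆ stdSimplex ℝ (Fin n)) (hnd : Nondegenerate R) :
    IsCompact {u : Fin n → ℝ | vecNorm R u ≤ 1} := by
  choose r hr hpos using hnd
  refine (isCompact_univ_pi fun i => isCompact_Icc (a := -√(1 / r i i))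
    (b := √(1 / r i i))).of_isClosed_subset ?_ fun u hu i _ => ?_
  · simp only [vecNorm_le_iff hR zero_le_one, Set.ofPred_forall]
    exact isClosed_iInter fun r => isClosed_iInter fun _ =>
      isClosed_le (by fun_prop) continuous_const
  · rw [Set.mem_Icc, ← abs_le]
    refine Real.abs_le_sqrt ?_
    rw [le_div_iff₀ (hpos i), mul_comm]
    have h := (vecNorm_le_iff hR zero_le_one).1 hu (r i) (hr i)
    rw [one_pow] at h
    exact (Finset.single_le_sum (f := fun k => r i k * u k ^ 2)
      (fun k _ => mul_nonneg ((hR (hr i)).1 k) (sq_nonneg _)) (Finset.mem_univ i)).trans h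

lemma isClosed_rankOneHull (hR : R ⊆ stdSimplex ℝ (Fin n)) (hC : C ⊆ stdSimplex ℝ (Fin m))
    (hRne : R.Nonempty) (hCne : C.Nonempty) (hRnd : Nondegenerate R) (hCnd : Nondegenerate C) :
    IsClosed (rankOneHull R C) := by
  rw [rankOneHull_eq hR hC hRne hCne]
  refine (isCompact_convexHull ?_).isClosed
  convert ((isCompact_vecNorm_le_one hR hRnd).prod (isCompact_vecNorm_le_one hC hCnd)).image
    (f := fun p : (Fin n → ℝ) × (Fin m → ℝ) => Matrix.vecMulVec p.1 p.2)
    (continuous_fst.matrix_vecMulVec continuous_snd) using 1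
  ext X
  simp [eq_comm]

lemma vecNorm_le_one_of_abs_le (hR : R ⊆ stdSimplex ℝ (Fin n)) (hRne : R.Nonempty)
    {u : Fin n → ℝ} (hu : ∀ i, |u i| ≤ 1) : vecNorm R u ≤ 1 := by
  rw [← vecNorm_one hR hRne]
  exact vecNorm_mono hR fun i => by simpa using hu i

/-- A matrix with entries below `1/N`, `N = nm`, is the average of `N` single-entry matrices with
entries below 1 in modulus; these are outer products of vectors in the unit cubes, which the
seminorm balls contain. -/
lemma zero_mem_interior_rankOneHull (hR : R ⊆ stdSimplex ℝ (Fin n))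
    (hC : C ⊆ stdSimplex ℝ (Fin m)) (hRne : R.Nonempty) (hCne : C.Nonempty) :
    (0 : Matrix (Fin n) (Fin m) ℝ) ∈ interior (rankOneHull R C) := by
  have hn : Nonempty (Fin n) := by
    obtain ⟨r, hr⟩ := hRne
    by_contra! h
    simpa using (hR hr).2
  have hm : Nonempty (Fin m) := by
    obtain ⟨c, hc⟩ := hCne
    by_contra! h
    simpa using (hC hc).2
  set N : ℝ := (Fintype.card (Fin n × Fin m) : ℝ) with hN
  have hN0 : 0 < N := by
    rw [hN]
    exact_mod_cast Fintype.card_pos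
  rw [mem_interior]
  refine ⟨{X | ∀ i j, |X i j| < N⁻¹}, fun X hX => ?_, ?_, fun _ _ => by simpa using hN0⟩
  · rw [rankOneHull_eq hR hC hRne hCne]
    have hsum : X = ∑ p : Fin n × Fin m, N⁻¹ • Matrix.single p.1 p.2 (N * X p.1 p.2) := by
      conv_lhs => rw [Matrix.matrix_eq_sum_single X]
      rw [Fintype.sum_prod_type]
      refine Finset.sum_congr rfl fun i _ => Finset.sum_congr rfl fun j _ => ?_
      rw [Matrix.smul_single, smul_eq_mul, inv_mul_cancel_left₀ hN0.ne']
    rw [hsum]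
    refine (convex_convexHull ℝ _).sum_mem (fun _ _ => (inv_pos.2 hN0).le) ?_ fun p _ =>
      subset_convexHull ℝ _ ⟨Pi.single p.1 (N * X p.1 p.2), Pi.single p.2 1, ?_, ?_, ?_⟩
    · rw [Finset.sum_const, Finset.card_univ, nsmul_eq_mul, ← hN, mul_inv_cancel₀ hN0.ne']
    · refine vecNorm_le_one_of_abs_le hR hRne fun i => ?_
      rw [Pi.single_apply]
      split_ifs
      · rw [abs_mul, abs_of_pos hN0]
        have := mul_le_mul_of_nonneg_left (hX p.1 p.2).le hN0.le
        rwa [mul_inv_cancel₀ hN0.ne'] at this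
      · simp
    · refine vecNorm_le_one_of_abs_le hC hCne fun j => ?_
      rw [Pi.single_apply]
      split_ifs <;> simp
    · ext i j
      simp [Matrix.vecMulVec_apply, Matrix.single_apply, Pi.single_apply, ite_and, eq_comm]
      split_ifs <;> rfl
  · simp only [Set.ofPred_forall]
    refine isOpen_iInter_of_finite fun i => isOpen_iInter_of_finite fun j =>
      isOpen_lt (continuous_id.matrix_elem i j).abs continuous_const

lemma GrothendieckInequality.inv_smul_mem_closure {K : ℝ} (hK : GrothendieckInequality K)
    (hR : R ⊆ stdSimplex ℝ (Fin n)) (hC : C ⊆ stdSimplex ℝ (Fin m))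
    (hRconv : Convex ℝ R) (hCconv : Convex ℝ C) (hRne : R.Nonempty) (hCne : C.Nonempty)
    {X : Matrix (Fin n) (Fin m) ℝ} (hX : rcNorm R C X ≤ 1) :
    K⁻¹ • X ∈ closure (rankOneHull R C) := by
  by_contra hmem
  have hK0 : 0 < K := zero_lt_one.trans_le hK.one_le
  have := locallyConvexSpace_matrix (Fin n) (Fin m)
  have hconv : Convex ℝ (closure (rankOneHull R C)) := (convex_convexHull ℝ _).closure
  obtain ⟨f, s, hfs, hsX⟩ := geometric_hahn_banach_closed_point hconv isClosed_closure hmem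
  have hs : 0 < s := by
    simpa using hfs 0 (subset_closure (interior_subset
      (zero_mem_interior_rankOneHull hR hC hRne hCne)))
  have h := hK.sum_mul_le hR hC hRconv hCconv hRne hCne hX
    (Y := Matrix.of fun i j => s⁻¹ * f (Matrix.single i j 1)) fun u v hu hv => by
      have h1 := hfs (Matrix.vecMulVec u v) (subset_closure (by
        rw [rankOneHull_eq hR hC hRne hCne]
        exact subset_convexHull ℝ _ ⟨u, v, hu, hv, rfl⟩))
      have e : ∑ i, ∑ j, Matrix.of (fun i j => s⁻¹ * f (Matrix.single i j 1)) i j * (u i * v j) =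
          s⁻¹ * f (Matrix.vecMulVec u v) := by
        rw [map_eq_sum_single]
        simp only [Finset.mul_sum, Matrix.of_apply, Matrix.vecMulVec_apply]
        refine Finset.sum_congr rfl fun i _ => Finset.sum_congr rfl fun j _ => ?_
        ring
      rw [e, inv_mul_le_one₀ hs]
      exact h1.le
  have e : ∑ i, ∑ j, X i j * Matrix.of (fun i j => s⁻¹ * f (Matrix.single i j 1)) i j =
      s⁻¹ * f X := by
    rw [map_eq_sum_single f X]
    simp only [Finset.mul_sum, Matrix.of_apply]
    refine Finset.sum_congr rfl fun i _ => Finset.sum_congr rfl fun j _ => ?_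
    ring
  rw [e, inv_mul_le_iff₀ hs] at h
  rw [map_smul, smul_eq_mul, lt_inv_mul_iff₀ hK0] at hsX
  linarith

end Inclusion

end LocalMaxNorm

theorem theorem2 {n m : ℕ} (R : Set (Fin n → ℝ)) (C : Set (Fin m → ℝ))
    (hRsub : R ⊆ stdSimplex ℝ (Fin n)) (hCsub : C ⊆ stdSimplex ℝ (Fin m))
    (hRconv : Convex ℝ R) (hCconv : Convex ℝ C)
    (hRne : R.Nonempty) (hCne : C.Nonempty) :
    -- Grothendieck's inequality holds, with a smallest constant, which is at most `1.79`
    (IsLeast {K : ℝ | LocalMaxNorm.GrothendieckInequality K} LocalMaxNorm.grothendieckConstant ∧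
      LocalMaxNorm.grothendieckConstant ≤ 1.79) ∧
    -- first inclusion
    LocalMaxNorm.rankOneHull R C ⊆ {X | LocalMaxNorm.rcNorm R C X ≤ 1} ∧
    -- second inclusion, when the `(R, C)`-norm is a norm
    (LocalMaxNorm.Nondegenerate R → LocalMaxNorm.Nondegenerate C →
      {X | LocalMaxNorm.rcNorm R C X ≤ 1} ⊆
        LocalMaxNorm.grothendieckConstant • LocalMaxNorm.rankOneHull R C) ∧
    -- second inclusion without this assumption, with any larger constant
    (∀ K : ℝ, LocalMaxNorm.grothendieckConstant < K →
      {X | LocalMaxNorm.rcNorm R C X ≤ 1} ⊆ K • LocalMaxNorm.rankOneHull R C) := by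
  have hleast := LocalMaxNorm.isLeast_grothendieckConstant
  have hG : LocalMaxNorm.GrothendieckInequality LocalMaxNorm.grothendieckConstant := hleast.1
  have hG0 : 0 < LocalMaxNorm.grothendieckConstant := zero_lt_one.trans_le hG.one_le
  refine ⟨⟨hleast, hleast.2 LocalMaxNorm.grothendieckInequality_of_krivine⟩,
    LocalMaxNorm.rankOneHull_subset hRsub hCsub, fun hRnd hCnd X hX => ?_, fun K hK X hX => ?_⟩
  · rw [Set.mem_smul_set_iff_inv_smul_mem₀ hG0.ne',
      ← (LocalMaxNorm.isClosed_rankOneHull hRsub hCsub hRne hCne hRnd hCnd).closure_eq]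
    exact hG.inv_smul_mem_closure hRsub hCsub hRconv hCconv hRne hCne hX
  · have hK0 : 0 < K := hG0.trans hK
    rw [Set.mem_smul_set_iff_inv_smul_mem₀ hK0.ne']
    -- With `G` the Grothendieck constant, `K⁻¹ X = (G/K) (G⁻¹ X) + (1 - G/K) 0` lies strictly
    -- between a closure point and an interior point.
    refine interior_subset ((convex_convexHull ℝ _).openSegment_closure_interior_subset_interior
      (hG.inv_smul_mem_closure hRsub hCsub hRconv hCconv hRne hCne hX)
      (LocalMaxNorm.zero_mem_interior_rankOneHull hRsub hCsub hRne hCne)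
      ⟨LocalMaxNorm.grothendieckConstant / K, 1 - LocalMaxNorm.grothendieckConstant / K,
        div_pos hG0 hK0, sub_pos.2 ((div_lt_one hK0).2 hK), by ring, ?_⟩)
    rw [smul_zero, add_zero, smul_smul]
    congr 1
    field_simp
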